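/- Throughout, $\mathcal H$ is a separable, infinite-dimensional real Hilbert space, $x\otimes y=\langle x,\cdot\rangle y$, $\|\cdot\|_{\mathcal L}$ and $\|\cdot\|_{\mathcal S}$ are the operator and Hilbert--Schmidt (H-S) norms, $\langle\cdot,\cdot\rangle_{\mathcal S}$ is the H-S inner product, $\mathscr C_{X,Y}=\mathbb E[X-\mathbb EX]\otimes[Y-\mathbb EY]$, $\mathscr C_X=\mathscr C_{X,X}$, and all asymptotic statements are for $N\to\infty$. **Process.** Let $X=(X_k)_{k\in\mathbb Z}\subset L^2_{\mathcal H}$ be a centered, strictly stationary fARMA$(1,1)$ process, $X_k=\varepsilon_k+\alpha_1(X_{k-1})+\beta_1(\varepsilon_{k-1})$ a.s., where $\alpha_1,\beta_1\neq 0$ are bounded operators and $(\varepsilon_k)\subset L^4_{\mathcal H}$ is a strictly stationary, ergodic, centered white noise whose covariance operator is injective. Assume that $X$ is a causal linear process, $X_k=\varepsilon_k+\sum_{j\ge1}\phi_j(\varepsilon_{k-j})$ with $\sum_j\|\phi_j\|_{\mathcal L}<\infty$, and invertible, $X_k=\varepsilon_k+\sum_{j\ge1}\psi_j(X_{k-j})$,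 with bounded operators $\phi_j,\psi_j$. **Estimators.** Put $X^{[L]}_k=(X_k,\dots,X_{k-L+1})\in\mathcal H^L$, $\mathscr C_L=\mathscr C_{X^{[L]}_0}$, $\mathscr D_L=\mathscr C_{X_0^{[L]},X_1}$, $\hat{\mathscr C}_L=\frac1{N-L+1}\sum_{k=L}^N X^{[L]}_k\otimes X^{[L]}_k$, $\hat{\mathscr D}_L=\frac1{N-L}\sum_{k=L}^{N-1}X^{[L]}_k\otimes X_{k+1}$, and $\Psi_L=(\psi_1\cdots\psi_L):\mathcal H^L\to\mathcal H$. All sequences of eigenpairs below are indexed by $j\ge1$, have nonincreasing eigenvalues and an orthonormal basis of eigenfunctions: $(\lambda_j,c_j)=(\lambda_j(L),c_j(L))$ of $\mathscr C_L$, $(\hat\lambda_j,\hat c_j)$ of $\hat{\mathscr C}_L$, $(\mu_j,d_j)$ of $\mathscr C_{X_0}$, and $(\rho_j,f_j)$ of $\psi_1\psi_1^*$. Let $K_N,L_N,M_N\in\mathbb N$ tend to $\infty$, let $\theta_N,\gamma_N>0$ tend to $0$, and write $K,L,M$ for $K_N,L_N,M_N$. With $\Pi_{e_1}^{e_n}$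 the orthogonal projection onto $\mathrm{span}\{e_1,\dots,e_n\}$, put $$\hat\Psi_L=\hat{\mathscr D}_L(\hat{\mathscr C}_L+\theta_N\mathbb I)^{-1}\Pi_{\hat c_1}^{\hat c_K},$$ let $\hat\psi_i$ be the $i$-th component of $\hat\Psi_L$, let $(\hat\rho_j,\hat f_j)$ be the eigenpairs of $\hat\psi_1\hat\psi_1^*$, and put $$\hat\beta_1=-\hat\psi_2\hat\psi_1^*(\hat\psi_1\hat\psi_1^*+\gamma_N\mathbb I)^{-1}\Pi_{\hat f_1}^{\hat f_M},\qquad \hat\alpha_1=\hat\psi_1-\hat\beta_1 .$$ **Assumptions.** With $\Lambda_K=\sup_{1\le j\le K}(\lambda_j-\lambda_{j+1})^{-1}$ and $P_M=\sup_{1\le j\le M}(\rho_j-\rho_{j+1})^{-1}$, and for some $\beta,\gamma>0$, suppose: 1. $L=o(N^{1/3})$, $\|\hat{\mathscr C}_L-\mathscr C_L\|_{\mathcal S}=O_{\mathbb P}(L^{3/2}N^{-1/2})$ and $\|\hat{\mathscr D}_L-\mathscr D_L\|_{\mathcal S}=O_{\mathbb P}(LN^{-1/2})$. 2. $\lambda_j(L)\ne\lambda_{j+1}(L)$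 for all $L=L_N$ and $j$, and $\rho_j\neq\rho_{j+1}$ for all $j$. 3. $\sum_i\|\psi_i\|_{\mathcal S}^2<\infty$, $\alpha_1$ and $\beta_1$ are H-S operators, and the image of $\psi_1$ is dense. 4. For every $L=L_N$, $\sum_{i,j\ge1}\langle\Psi_L,c_i\otimes d_j\rangle_{\mathcal S}^2(1+i^{2\beta}+j^{2\beta})<\infty$, and the parts of these sums over the indices with $\max(i,j)>K$ remain bounded: $$\sum_{\max(i,j)>K}\langle\Psi_L,c_i\otimes d_j\rangle_{\mathcal S}^2(1+i^{2\beta}+j^{2\beta})=O(1).$$ (The latter holds in particular if the full sums converge to a finite limit as $N\to\infty$.) 5. $\sum_{i,j\ge1}\langle\beta_1,f_i\otimes f_j\rangle_{\mathcal S}^2(1+i^{2\gamma}+j^{2\gamma})<\infty$. 6. $\sum_\ell\|\psi_\ell\|_{\mathcal L}<\infty$, $\theta_N=o(\lambda_K)$, $K^{1+\beta}\lambda_K^{-1}\Lambda_KL^2=O(N^{1/2})$, $\sum_{\ell>L}\|\psi_\ell\|_{\mathcal L}=o(K\Lambda_KL^{3/2}N^{-1/2})$ and $\theta_N=o(K\Lambda_KL^2N^{-1/2})$.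 7. $M^{1+\gamma}\rho_M^{-1}P_M=O(K^\beta)$ and $\gamma_N=o(\rho_MM^{-\gamma})$. **Conclusion.** $$\max\{\|\hat\alpha_1-\alpha_1\|_{\mathcal S},\ \|\hat\beta_1-\beta_1\|_{\mathcal S}\}=O_{\mathbb P}(M^{-\gamma}).$$ -/

import Mathlib

open MeasureTheory ProbabilityTheory Filter Topology Asymptotics
open scoped ENNReal NNReal

namespace FARMA

noncomputable section

/-! ### Hilbert-Schmidt operators between real Hilbert spaces -/

section HilbertSchmidt

variable {E F : Type*} [NormedAddCommGroup E] [InnerProductSpace ℝ E] [CompleteSpace E]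
  [NormedAddCommGroup F] [InnerProductSpace ℝ F]

/-- The tensorial product `x ⊗ y = ⟨x, ·⟩ y`. -/
def tensor {E F : Type*} [NormedAddCommGroup E] [InnerProductSpace ℝ E]
    [NormedAddCommGroup F] [InnerProductSpace ℝ F] (x : E) (y : F) : E →L[ℝ] F :=
  InnerProductSpace.rankOne ℝ y x

variable (E) in
/-- The index set of an orthonormal basis of `E`. -/
def onbIndex : Set E := (exists_hilbertBasis ℝ E).choose

variable (E) in
/-- Some orthonormal basis of `E`. -/
def onb : HilbertBasis (onbIndex E) ℝ E := (exists_hilbertBasis ℝ E).choose_spec.choose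

/-- The Hilbert-Schmidt norm `(∑ᵢ ‖A eᵢ‖²)^(1/2)`, equal to `∞` if `A` is not Hilbert-Schmidt.
By `hsENorm_eq` it does not depend on the orthonormal basis. -/
def hsENorm (A : E →L[ℝ] F) : ℝ≥0∞ := (∑' i, ‖A (onb E i)‖ₑ ^ 2) ^ (1 / 2 : ℝ)

/-- `A` is a Hilbert-Schmidt operator. -/
def IsHS (A : E →L[ℝ] F) : Prop := hsENorm A < ∞

/-- The Hilbert-Schmidt inner product `∑ᵢ ⟨A eᵢ, B eᵢ⟩`. -/
def hsInner (A B : E →L[ℝ] F) : ℝ := ∑' i, inner ℝ (A (onb E i)) (B (onb E i))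

theorem enorm_sq_eq_tsum {G ι : Type*} [NormedAddCommGroup G] [InnerProductSpace ℝ G]
    (b : HilbertBasis ι ℝ G) (x : G) : ‖x‖ₑ ^ 2 = ∑' i, ‖inner ℝ (b i) x‖ₑ ^ 2 := by
  have h := b.hasSum_inner_mul_inner x x
  have h' : HasSum (fun i => ‖inner ℝ (b i) x‖ ^ 2) (‖x‖ ^ 2) := by
    rw [← real_inner_self_eq_norm_sq]
    refine h.congr_fun ?_
    intro i
    rw [real_inner_comm x (b i), Real.norm_eq_abs, sq_abs, sq]
  have e : ∀ y : ℝ, ENNReal.ofReal (‖y‖ ^ 2) = ‖y‖ₑ ^ 2 := fun y => by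
    rw [ENNReal.ofReal_pow (norm_nonneg _), ofReal_norm]
  rw [← ofReal_norm, ← ENNReal.ofReal_pow (norm_nonneg _), ← h'.tsum_eq,
    ENNReal.ofReal_tsum_of_nonneg (fun i => by positivity) h'.summable]
  exact tsum_congr fun i => e _

theorem tsum_enorm_sq_eq_adjoint [CompleteSpace F] {ι : Type*} (b : HilbertBasis ι ℝ E)
    (A : E →L[ℝ] F) :
    ∑' i, ‖A (b i)‖ₑ ^ 2 = ∑' j, ‖ContinuousLinearMap.adjoint A (onb F j)‖ₑ ^ 2 := by
  have h1 : ∀ i, ‖A (b i)‖ₑ ^ 2 = ∑' j, ‖inner ℝ (onb F j) (A (b i))‖ₑ ^ 2 :=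
    fun i => enorm_sq_eq_tsum (onb F) _
  have h2 : ∀ j, ‖ContinuousLinearMap.adjoint A (onb F j)‖ₑ ^ 2
      = ∑' i, ‖inner ℝ (b i) (ContinuousLinearMap.adjoint A (onb F j))‖ₑ ^ 2 :=
    fun j => enorm_sq_eq_tsum b _
  rw [tsum_congr h1, tsum_congr h2, ENNReal.tsum_comm]
  refine tsum_congr fun j => tsum_congr fun i => ?_
  rw [ContinuousLinearMap.adjoint_inner_right, real_inner_comm]

/-- The Hilbert-Schmidt norm can be computed in every orthonormal basis. -/
theorem hsENorm_eq [CompleteSpace F] {ι : Type*} (b : HilbertBasis ι ℝ E) (A : E →L[ℝ] F) :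
    hsENorm A = (∑' i, ‖A (b i)‖ₑ ^ 2) ^ (1 / 2 : ℝ) := by
  rw [hsENorm, tsum_enorm_sq_eq_adjoint, ← tsum_enorm_sq_eq_adjoint b]

theorem hsInner_tensor (A : E →L[ℝ] F) (x : E) (y : F) :
    hsInner A (tensor x y) = inner ℝ (A x) y := by
  have h := ((onb E).hasSum_repr x).mapL ((innerSL ℝ y).comp A)
  rw [← real_inner_comm, hsInner]
  refine (h.congr_fun ?_).tsum_eq
  intro i
  simp [tensor, inner_smul_right, (onb E).repr_apply_apply, real_inner_comm]

end HilbertSchmidt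

/-! ### Eigenpairs, projections, Sobolev sums.
Sequences of eigenpairs are indexed from `0`: entry `j` is the pair with number `j + 1`. -/

section Eigen

variable {E F : Type*} [NormedAddCommGroup E] [InnerProductSpace ℝ E]
  [NormedAddCommGroup F] [InnerProductSpace ℝ F]

/-- `(lam j, e j)` is the sequence of eigenvalue/eigenfunction pairs of `T`: the eigenvalues are
listed in nonincreasing order with multiplicity, the eigenfunctions form a complete orthonormal
system. -/
structure IsEigenSystem (T : E →L[ℝ] E) (lam : ℕ → ℝ) (e : HilbertBasis ℕ ℝ E) : Prop where
  antitone : Antitone lam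
  eigen : ∀ j, T (e j) = lam j • e j

/-- The reciprocal eigengap `sup_{1 ≤ j ≤ k} (λ_j - λ_{j+1})⁻¹`. -/
def gapSup (lam : ℕ → ℝ) (k : ℕ) : ℝ := ⨆ j : Fin k, (lam j - lam (j + 1))⁻¹

/-- The orthogonal projection onto the span of the first `k` elements of `e`. -/
def projFirst (e : HilbertBasis ℕ ℝ E) (k : ℕ) : E →L[ℝ] E :=
  haveI : FiniteDimensional ℝ (Submodule.span ℝ (e '' Set.Iio k)) :=
    FiniteDimensional.span_of_finite ℝ ((Set.finite_Iio k).image _)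
  (Submodule.span ℝ (e '' Set.Iio k)).starProjection

variable [CompleteSpace E]

/-- The `(i, j)` term `⟨A, c_i ⊗ d_j⟩² (1 + i^{2s} + j^{2s})` of a Sobolev sum of order `s`. -/
def sobolevTerm (A : E →L[ℝ] F) (c : HilbertBasis ℕ ℝ E) (d : HilbertBasis ℕ ℝ F) (s : ℝ)
    (i j : ℕ) : ℝ≥0∞ :=
  ENNReal.ofReal (hsInner A (tensor (c i) (d j)) ^ 2 *
    (1 + ((i : ℝ) + 1) ^ (2 * s) + ((j : ℝ) + 1) ^ (2 * s)))

/-- The Sobolev sum `∑_i ∑_j ⟨A, c_i ⊗ d_j⟩² (1 + i^{2s} + j^{2s})`. -/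
def sobolevSum (A : E →L[ℝ] F) (c : HilbertBasis ℕ ℝ E) (d : HilbertBasis ℕ ℝ F) (s : ℝ) :
    ℝ≥0∞ := ∑' i, ∑' j, sobolevTerm A c d s i j

/-- The part of the Sobolev sum with `max (i, j) > k` (in the numbering from `1`). -/
def sobolevTail (A : E →L[ℝ] F) (c : HilbertBasis ℕ ℝ E) (d : HilbertBasis ℕ ℝ F) (s : ℝ)
    (k : ℕ) : ℝ≥0∞ := ∑' i, ∑' j, if k < max (i + 1) (j + 1) then sobolevTerm A c d s i j else 0

theorem sobolevTail_le (A : E →L[ℝ] F) (c : HilbertBasis ℕ ℝ E) (d : HilbertBasis ℕ ℝ F) (s : ℝ)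
    (k : ℕ) : sobolevTail A c d s k ≤ sobolevSum A c d s :=
  ENNReal.tsum_le_tsum fun i => ENNReal.tsum_le_tsum fun j => by split_ifs <;> simp

/-- Sobolev sums that converge to a finite limit have eventually bounded tails, whatever the
truncation levels. -/
theorem sobolevTail_bounded_of_tendsto {E : ℕ → Type*} [∀ N, NormedAddCommGroup (E N)]
    [∀ N, InnerProductSpace ℝ (E N)] [∀ N, CompleteSpace (E N)] (A : ∀ N, E N →L[ℝ] F)
    (c : ∀ N, HilbertBasis ℕ ℝ (E N)) (d : HilbertBasis ℕ ℝ F) (s : ℝ) (K : ℕ → ℕ) (S : ℝ≥0)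
    (h : Tendsto (fun N => sobolevSum (A N) (c N) d s) atTop (𝓝 (S : ℝ≥0∞))) :
    ∃ B : ℝ≥0, ∀ᶠ N in atTop, sobolevTail (A N) (c N) d s (K N) ≤ B :=
  ⟨S + 1, (h.eventually_lt_const (ENNReal.coe_lt_coe.2 (lt_add_one S))).mono fun _ hN =>
    (sobolevTail_le _ _ _ _ _).trans hN.le⟩

end Eigen

/-! ### Processes in a separable Hilbert space -/

section Processes

variable {H G Ω : Type*} [NormedAddCommGroup H] [InnerProductSpace ℝ H]
  [NormedAddCommGroup G] [InnerProductSpace ℝ G] [MeasurableSpace Ω]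

/-- `Y_N = O_P(c_N)` for nonnegative `Y_N` (possibly infinite) and positive `c_N`:
`Y_N / c_N` is stochastically bounded as `N → ∞`. -/
def IsBigOP (μ : Measure Ω) (Y : ℕ → Ω → ℝ≥0∞) (c : ℕ → ℝ) : Prop :=
  ∀ η : ℝ≥0∞, 0 < η → ∃ C : ℝ, ∀ᶠ N in atTop, μ {ω | ENNReal.ofReal (C * c N) < Y N ω} ≤ η

/-- The cross-covariance operator `E (X - E X) ⊗ (Y - E Y)`. -/
def crossCov (μ : Measure Ω) (X : Ω → H) (Y : Ω → G) : H →L[ℝ] G :=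
  ∫ ω, tensor (X ω - ∫ ω', X ω' ∂μ) (Y ω - ∫ ω', Y ω' ∂μ) ∂μ

/-- The covariance operator of `X`. -/
def cov (μ : Measure Ω) (X : Ω → H) : H →L[ℝ] H := crossCov μ X X

/-- All random variables of the process are centered. -/
def IsCentered (μ : Measure Ω) (X : ℤ → Ω → H) : Prop := ∀ k, ∫ ω, X k ω ∂μ = 0

/-- Strict stationarity: finite-dimensional distributions are invariant under time shifts. -/
def IsStrictlyStationary [MeasurableSpace H] (μ : Measure Ω) (X : ℤ → Ω → H) : Prop :=
  ∀ (n : ℕ) (t : Fin n → ℤ) (h : ℤ),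
    IdentDistrib (fun ω i => X (t i) ω) (fun ω i => X (t i + h) ω) μ μ

/-- Ergodicity: the time shift is ergodic for the law of the process on the path space. -/
def IsErgodic [MeasurableSpace H] (μ : Measure Ω) (X : ℤ → Ω → H) : Prop :=
  Ergodic (fun (x : ℤ → H) (k : ℤ) => x (k + 1)) (μ.map fun ω k => X k ω)

/-- White noise: a centered, weakly stationary process of non-degenerate, pairwise uncorrelated
random variables. -/
structure IsWhiteNoise (μ : Measure Ω) (ε : ℤ → Ω → H) : Prop where
  memLp : ∀ k, MemLp (ε k) 2 μ
  centered : IsCentered μ ε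
  weaklyStationary : ∀ h k l : ℤ, crossCov μ (ε k) (ε l) = crossCov μ (ε (k + h)) (ε (l + h))
  nondegenerate : ∀ k, 0 < ∫ ω, ‖ε k ω‖ ^ 2 ∂μ
  uncorrelated : ∀ k l : ℤ, k ≠ l → crossCov μ (ε k) (ε l) = 0

/-- Invertible process: centered, stationary, and `X_k = ∑_{j ≥ 1} ψ_j (X_{k-j}) + ε_k` almost
surely for all `k`. The value `ψ 0` is not used. -/
structure IsInvertible [MeasurableSpace H] (μ : Measure Ω) (X ε : ℤ → Ω → H)
    (ψ : ℕ → H →L[ℝ] H) : Prop where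
  centered : IsCentered μ X
  stationary : IsStrictlyStationary μ X
  eq : ∀ k : ℤ, ∀ᵐ ω ∂μ,
    HasSum (fun j : ℕ => ψ (j + 1) (X (k - ((j : ℤ) + 1)) ω)) (X k ω - ε k ω)

/-- Causal linear process: `X_k = ε_k + ∑_{j ≥ 1} φ_j (ε_{k-j})` almost surely for all `k`, with
`∑_{j ≥ 1} ‖φ_j‖ < ∞`. The value `φ 0` is not used. -/
structure IsCausalLinear (μ : Measure Ω) (X ε : ℤ → Ω → H) (φ : ℕ → H →L[ℝ] H) : Prop where
  summable : Summable fun j : ℕ => ‖φ (j + 1)‖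
  eq : ∀ k : ℤ, ∀ᵐ ω ∂μ,
    HasSum (fun j : ℕ => φ (j + 1) (ε (k - ((j : ℤ) + 1)) ω)) (X k ω - ε k ω)

/-- Functional ARMA(1,1) process with operators `α₁`, `β₁` and white noise `ε`. -/
structure IsFARMA11 (μ : Measure Ω) (X ε : ℤ → Ω → H) (α₁ β₁ : H →L[ℝ] H) : Prop where
  centered : IsCentered μ X
  whiteNoise : IsWhiteNoise μ ε
  α₁_ne : α₁ ≠ 0
  β₁_ne : β₁ ≠ 0
  eq : ∀ k : ℤ, ∀ᵐ ω ∂μ, X k ω = ε k ω + α₁ (X (k - 1) ω) + β₁ (ε (k - 1) ω)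

/-- The Cartesian product Hilbert space `H^L`. -/
abbrev Lag (H : Type*) (L : ℕ) : Type _ := PiLp 2 fun _ : Fin L => H

/-- The lagged vector `X^{[L]}_k = (X_k, X_{k-1}, …, X_{k-L+1})`. -/
def lagVec (X : ℤ → Ω → H) (L : ℕ) (k : ℤ) (ω : Ω) : Lag H L :=
  WithLp.toLp 2 fun i : Fin L => X (k - (i : ℕ)) ω

/-- The empirical covariance operator
`(N - L + 1)⁻¹ ∑_{k=L}^{N} X^{[L]}_k ⊗ X^{[L]}_k` (meant for `L ≤ N`). -/
def empCov (X : ℤ → Ω → H) (L N : ℕ) (ω : Ω) : Lag H L →L[ℝ] Lag H L :=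
  ((N : ℝ) - L + 1)⁻¹ •
    ∑ k ∈ Finset.Icc L N, tensor (lagVec X L (k : ℤ) ω) (lagVec X L (k : ℤ) ω)

/-- The empirical lag-1 cross-covariance operator
`(N - L)⁻¹ ∑_{k=L}^{N-1} X^{[L]}_k ⊗ X_{k+1}` (meant for `L < N`). -/
def empCross (X : ℤ → Ω → H) (L N : ℕ) (ω : Ω) : Lag H L →L[ℝ] H :=
  ((N : ℝ) - L)⁻¹ •
    ∑ k ∈ Finset.Ico L N, tensor (lagVec X L (k : ℤ) ω) (X ((k : ℤ) + 1) ω)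

/-- The row operator `(ψ_1 ⋯ ψ_L) : H^L → H`. -/
def rowOp (ψ : ℕ → H →L[ℝ] H) (L : ℕ) : Lag H L →L[ℝ] H :=
  ∑ i : Fin L, ψ (i + 1) ∘L PiLp.proj 2 (fun _ : Fin L => H) i

/-- The `j`-th component (`j = 1, …, L`) of an operator `H^L → H`. -/
def component {L : ℕ} (A : Lag H L →L[ℝ] H) (j : ℕ) : H →L[ℝ] H :=
  A ∘L ((PiLp.continuousLinearEquiv 2 ℝ fun _ : Fin L => H).symm : (Fin L → H) →L[ℝ] Lag H L) ∘L
    ContinuousLinearMap.pi fun i : Fin L =>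
      if (i : ℕ) + 1 = j then ContinuousLinearMap.id ℝ H else 0

/-- The Tychonoff-regularized Yule-Walker estimator `D̂ (Ĉ + θ I)⁻¹ Π` of `(ψ_1 ⋯ ψ_L)`, where `Π`
projects onto the span of the first `K` elements of `c`. -/
def rowEst (X : ℤ → Ω → H) (L N K : ℕ) (θ : ℝ) (c : HilbertBasis ℕ ℝ (Lag H L)) (ω : Ω) :
    Lag H L →L[ℝ] H :=
  empCross X L N ω ∘L Ring.inverse (empCov X L N ω + θ • 1) ∘L projFirst c K

variable [CompleteSpace H]

/-- The operator `-P₂ P₁* (P₁ P₁* + g I)⁻¹ Π`, where `P₁`, `P₂` are the first two components of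
`P` and `Π` projects onto the span of the first `M` elements of `f`. -/
def betaEst {L : ℕ} (P : Lag H L →L[ℝ] H) (M : ℕ) (g : ℝ) (f : HilbertBasis ℕ ℝ H) : H →L[ℝ] H :=
  -(component P 2 ∘L ContinuousLinearMap.adjoint (component P 1) ∘L
    Ring.inverse (component P 1 ∘L ContinuousLinearMap.adjoint (component P 1) + g • 1) ∘L
    projFirst f M)

/-- The first component of `P` minus `betaEst`. -/
def alphaEst {L : ℕ} (P : Lag H L →L[ℝ] H) (M : ℕ) (g : ℝ) (f : HilbertBasis ℕ ℝ H) :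
    H →L[ℝ] H :=
  component P 1 - betaEst P M g f

end Processes

end

end FARMA

open FARMA

/-! Randomness enters only through two events. When the errors of `empCov` and `empCross` are within
constant multiples of their rates, every other inequality holds outcome by outcome;
`IsBigOP.of_eventually_forall` turns this into a statement in probability.

Both estimation stages have one shape. An operator S is recovered from T' close to T and D close to
S T' as D (T' + θ)⁻¹ Π', where Π' and Π project onto the first k eigenvectors of T' and T. Since T'
(T' + θ)⁻¹ = 1 - θ (T' + θ)⁻¹, the error splits into a residual (D - S T') (T' + θ)⁻¹ Π', a bias -θ
S (T' + θ)⁻¹ Π', a rotation S (Π' - Π) and a truncation S Π - S. Weyl's inequality gives ‖(T' + θ)⁻¹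
Π'‖ ≤ 2 / λ_k, the Davis-Kahan theorem controls Π' - Π by the k-th gap, and the Sobolev condition
controls the truncation. This is `HSBound.regularized_inverse_sub`;
`HSBound.regularized_inverse_rate` converts growth conditions into a single rate.

In the first stage T is the covariance of the lagged vector, S = Ψ_L, and the rate is K^(-β). The
Yule-Walker equation D_L = Ψ_L C_L fails only by the tail of the inverted series
(`hsBound_crossCov_sub_rowOp_comp_cov`). Causality with summable coefficients bounds the spectra of
all C_L together (`exists_inner_crossMoment_lagVec_le`), so no constant depends on L.

In the second stage (`hsBound_betaEst_sub`) T = ψ₁ψ₁*, S = β₁, D = -ψ̂₂ψ̂₁*, the input error is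
K^(-β) and the rate is M^(-γ). It rests on ψ₁ = α₁ + β₁ and ψ₂ = -β₁ψ₁ (`coeff_eq_of_arma`).
Inserting the inverted process into the fARMA equation gives a vanishing series in present and past
values of X. Pairing it with the current innovation kills all but the leading term χ₀, so χ₀ C_ε =
0, and injectivity of C_ε forces χ₀ = 0; removing that term and shifting time treats the next
coefficient. The error of α̂₁ is the error of ψ̂₁ minus that of β̂₁. -/

namespace FARMA

/-! ### Calculus of Hilbert-Schmidt norms -/

section HilbertSchmidtBounds

variable {E F G : Type*} [NormedAddCommGroup E] [InnerProductSpace ℝ E] [CompleteSpace E]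
  [NormedAddCommGroup F] [InnerProductSpace ℝ F] [NormedAddCommGroup G] [InnerProductSpace ℝ G]

/-- The Hilbert-Schmidt norm of `A` is at most the real number `r ≥ 0`. -/
def HSBound (A : E →L[ℝ] F) (r : ℝ) : Prop := 0 ≤ r ∧ hsENorm A ≤ ENNReal.ofReal r

theorem hsENorm_sq {ι : Type*} [CompleteSpace F] (b : HilbertBasis ι ℝ E) (A : E →L[ℝ] F) :
    hsENorm A ^ 2 = ∑' i, ‖A (b i)‖ₑ ^ 2 := by
  rw [hsENorm_eq b, ← ENNReal.rpow_natCast, ← ENNReal.rpow_mul]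
  norm_num

theorem hsENorm_adjoint [CompleteSpace F] (A : E →L[ℝ] F) :
    hsENorm (ContinuousLinearMap.adjoint A) = hsENorm A := by
  rw [hsENorm, hsENorm, tsum_enorm_sq_eq_adjoint (onb E) A]

/-- Reduces to finite partial sums, where the finite Minkowski inequality is available for the
triangle inequality. -/
theorem hsENorm_le_iff (A : E →L[ℝ] F) (r : ℝ≥0∞) :
    hsENorm A ≤ r ↔ ∀ s : Finset (onbIndex E), (∑ i ∈ s, ‖A (onb E i)‖ₑ ^ (2 : ℝ)) ^ (1 / 2 : ℝ) ≤ r := by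
  have h : ∀ x : ℝ≥0∞, x ^ (1 / 2 : ℝ) ≤ r ↔ x ≤ r ^ (2 : ℝ) := fun x => by
    rw [one_div, ENNReal.rpow_inv_le_iff (by norm_num)]
  rw [hsENorm]
  simp_rw [h, ENNReal.rpow_two]
  rw [ENNReal.tsum_eq_iSup_sum, iSup_le_iff]

theorem hsENorm_add_le (A B : E →L[ℝ] F) : hsENorm (A + B) ≤ hsENorm A + hsENorm B := by
  rw [hsENorm_le_iff]
  intro s
  calc (∑ i ∈ s, ‖(A + B) (onb E i)‖ₑ ^ (2 : ℝ)) ^ (1 / 2 : ℝ)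
      ≤ (∑ i ∈ s, (‖A (onb E i)‖ₑ + ‖B (onb E i)‖ₑ) ^ (2 : ℝ)) ^ (1 / 2 : ℝ) := by
        gcongr
        exact enorm_add_le _ _
    _ ≤ _ := ENNReal.Lp_add_le _ _ _ (by norm_num)
    _ ≤ _ := add_le_add ((hsENorm_le_iff A _).1 le_rfl s) ((hsENorm_le_iff B _).1 le_rfl s)

/-- Basis independence lets the comparison be made on any one convenient basis; in the Davis-Kahan
bound this is the eigenbasis of the perturbed operator. The operator norm has no such property. -/
theorem hsENorm_le_of_forall_le {c : ℝ≥0∞} {ι : Type*} [CompleteSpace F] [CompleteSpace G]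
    (b : HilbertBasis ι ℝ E)
    {A : E →L[ℝ] F} {B : E →L[ℝ] G} (h : ∀ i, ‖A (b i)‖ₑ ≤ c * ‖B (b i)‖ₑ) :
    hsENorm A ≤ c * hsENorm B := by
  have : hsENorm A ^ 2 ≤ (c * hsENorm B) ^ 2 := by
    rw [mul_pow, hsENorm_sq b, hsENorm_sq b, ← ENNReal.tsum_mul_left]
    refine ENNReal.tsum_le_tsum fun i => ?_
    rw [← mul_pow]
    gcongr
    exact h i
  exact (ENNReal.pow_le_pow_left_iff two_ne_zero).1 this

/-- Passing to the adjoint moves the basis to the target: ‖A x‖² = ∑ ⟨A* b_j, x⟩², and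
Cauchy-Schwarz applies termwise. No basis containing x / ‖x‖ has to be built. -/
theorem enorm_apply_le_hsENorm [CompleteSpace F] (A : E →L[ℝ] F) (x : E) :
    ‖A x‖ₑ ≤ hsENorm A * ‖x‖ₑ := by
  have : ‖A x‖ₑ ^ 2 ≤ (hsENorm A * ‖x‖ₑ) ^ 2 := by
    rw [mul_pow, ← hsENorm_adjoint, hsENorm_sq (onb F), enorm_sq_eq_tsum (onb F),
      ← ENNReal.tsum_mul_right]
    refine ENNReal.tsum_le_tsum fun i => ?_
    rw [← mul_pow]
    gcongr
    rw [← ContinuousLinearMap.adjoint_inner_left]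
    simp only [enorm_eq_nnnorm]
    exact_mod_cast nnnorm_inner_le_nnnorm (𝕜 := ℝ) _ _
  exact (ENNReal.pow_le_pow_left_iff two_ne_zero).1 this

namespace HSBound

variable {A B : E →L[ℝ] F} {r s : ℝ}

theorem mono (h : HSBound A r) (hrs : r ≤ s) : HSBound A s :=
  ⟨h.1.trans hrs, h.2.trans (ENNReal.ofReal_le_ofReal hrs)⟩

theorem add (hA : HSBound A r) (hB : HSBound B s) : HSBound (A + B) (r + s) :=
  ⟨add_nonneg hA.1 hB.1, (hsENorm_add_le A B).trans
    ((add_le_add hA.2 hB.2).trans_eq (ENNReal.ofReal_add hA.1 hB.1).symm)⟩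

theorem neg (hA : HSBound A r) : HSBound (-A) r := by
  refine ⟨hA.1, le_trans (le_of_eq ?_) hA.2⟩
  simp [hsENorm]

theorem sub (hA : HSBound A r) (hB : HSBound B s) : HSBound (A - B) (r + s) := by
  rw [sub_eq_add_neg]
  exact hA.add hB.neg

variable [CompleteSpace F] [CompleteSpace G]

theorem of_forall_le {ι : Type*} (b : HilbertBasis ι ℝ E) {A : E →L[ℝ] F} {B : E →L[ℝ] G} {c : ℝ}
    (hc : 0 ≤ c) (hB : HSBound B r) (h : ∀ i, ‖A (b i)‖ ≤ c * ‖B (b i)‖) : HSBound A (c * r) := by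
  refine ⟨mul_nonneg hc hB.1, 
    (hsENorm_le_of_forall_le b (c := ENNReal.ofReal c) (B := B) fun i => ?_).trans ?_⟩
  · rw [← ofReal_norm, ← ofReal_norm, ← ENNReal.ofReal_mul hc]
    exact ENNReal.ofReal_le_ofReal (h i)
  · rw [ENNReal.ofReal_mul hc]
    gcongr
    exact hB.2

theorem norm_apply_le (hA : HSBound A r) (x : E) : ‖A x‖ ≤ r * ‖x‖ := by
  have := (enorm_apply_le_hsENorm A x).trans (mul_le_mul_left hA.2 _)
  rw [← ofReal_norm, ← ofReal_norm, ← ENNReal.ofReal_mul hA.1] at this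
  exact (ENNReal.ofReal_le_ofReal_iff (mul_nonneg hA.1 (norm_nonneg _))).1 this

theorem opNorm_le (hA : HSBound A r) : ‖A‖ ≤ r :=
  A.opNorm_le_bound hA.1 hA.norm_apply_le

theorem adjoint (hA : HSBound A r) : HSBound (ContinuousLinearMap.adjoint A) r :=
  ⟨hA.1, (hsENorm_adjoint A).trans_le hA.2⟩

theorem smul (hA : HSBound A r) {c : ℝ} (hc : 0 ≤ c) : HSBound (c • A) (c * r) :=
  hA.of_forall_le (onb E) hc fun _ => by simp [norm_smul, abs_of_nonneg hc]

theorem comp_left {c : ℝ} (hA : HSBound A r) (B : F →L[ℝ] G) (hB : ‖B‖ ≤ c) :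
    HSBound (B ∘L A) (c * r) :=
  hA.of_forall_le (onb E) ((norm_nonneg B).trans hB) fun _ => B.le_of_opNorm_le hB _

theorem comp_right {c : ℝ} {A : F →L[ℝ] G} (hA : HSBound A r) (B : E →L[ℝ] F) (hB : ‖B‖ ≤ c) :
    HSBound (A ∘L B) (r * c) := by
  have := (hA.adjoint.comp_left (ContinuousLinearMap.adjoint B) (c := c) (by simpa using hB)).adjoint
  rw [ContinuousLinearMap.adjoint_comp] at this
  simpa [mul_comm] using this

end HSBound

end HilbertSchmidtBounds

/-! ### Spectral projections and diagonal operators -/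

section EigenSystems

variable {E F : Type*} [NormedAddCommGroup E] [InnerProductSpace ℝ E]
  [NormedAddCommGroup F] [InnerProductSpace ℝ F]

theorem projFirst_apply_basis (e : HilbertBasis ℕ ℝ E) (k j : ℕ) :
    projFirst e k (e j) = if j < k then e j else 0 := by
  have : FiniteDimensional ℝ (Submodule.span ℝ (e '' Set.Iio k)) :=
    FiniteDimensional.span_of_finite ℝ ((Set.finite_Iio k).image _)
  rw [projFirst]
  split_ifs with h
  · exact Submodule.starProjection_eq_self_iff.2 (Submodule.subset_span ⟨j, h, rfl⟩)
  · rw [Submodule.starProjection_apply_eq_zero_iff, Submodule.mem_orthogonal]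
    intro u hu
    induction hu using Submodule.span_induction with
    | mem x hx =>
      obtain ⟨i, hi, rfl⟩ := hx
      exact e.orthonormal.2 (fun hij => h (hij ▸ hi))
    | zero => simp
    | add x y _ _ hx hy => rw [inner_add_left, hx, hy, add_zero]
    | smul a x _ hx => rw [inner_smul_left, hx, mul_zero]

theorem norm_projFirst_le (e : HilbertBasis ℕ ℝ E) (k : ℕ) : ‖projFirst e k‖ ≤ 1 := by
  have : FiniteDimensional ℝ (Submodule.span ℝ (e '' Set.Iio k)) :=
    FiniteDimensional.span_of_finite ℝ ((Set.finite_Iio k).image _)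
  exact Submodule.starProjection_norm_le _

theorem inner_projFirst_left (e : HilbertBasis ℕ ℝ E) (k : ℕ) (x y : E) :
    inner ℝ (projFirst e k x) y = inner ℝ x (projFirst e k y) := by
  have : FiniteDimensional ℝ (Submodule.span ℝ (e '' Set.Iio k)) :=
    FiniteDimensional.span_of_finite ℝ ((Set.finite_Iio k).image _)
  exact Submodule.inner_starProjection_left_eq_right _ x y

theorem hasSum_norm_sq_inner {ι : Type*} (b : HilbertBasis ι ℝ E) (x : E) :
    HasSum (fun i => inner ℝ (b i) x ^ 2) (‖x‖ ^ 2) := by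
  rw [← real_inner_self_eq_norm_sq]
  refine (b.hasSum_inner_mul_inner x x).congr_fun fun i => ?_
  rw [real_inner_comm x (b i), sq]

theorem inner_projFirst (e : HilbertBasis ℕ ℝ E) (k j : ℕ) (x : E) :
    inner ℝ (e j) (projFirst e k x) = if j < k then inner ℝ (e j) x else 0 := by
  rw [← inner_projFirst_left, projFirst_apply_basis]
  split_ifs <;> simp

/-- Expanding x in the basis replaces any symmetry hypothesis: an orthonormal eigenbasis already
makes the operator behave as a self-adjoint one. -/
theorem inner_apply_of_diagonal {ι : Type*} (b : HilbertBasis ι ℝ E) {A : E →L[ℝ] E} {a : ι → ℝ}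
    (hA : ∀ i, A (b i) = a i • b i) (i : ι) (x : E) :
    inner ℝ (b i) (A x) = a i * inner ℝ (b i) x := by
  have h := ((b.hasSum_repr x).mapL A).mapL (innerSL ℝ (b i))
  rw [innerSL_apply_apply] at h
  rw [h.unique (hasSum_single i fun j hj => ?_)]
  · simp [hA, b.repr_apply_apply, b.orthonormal.1 i, mul_comm]
  · simp [hA, b.orthonormal.2 hj.symm]

/-- An operator that is diagonal in an orthonormal basis is bounded by its entries. -/
theorem norm_le_of_diagonal {ι : Type*} (b : HilbertBasis ι ℝ E) {A : E →L[ℝ] E} {a : ι → ℝ}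
    (hA : ∀ i, A (b i) = a i • b i) {C : ℝ} (hC : 0 ≤ C) (ha : ∀ i, |a i| ≤ C) : ‖A‖ ≤ C := by
  refine A.opNorm_le_bound hC fun x => ?_
  refine le_of_sq_le_sq ?_ (by positivity)
  rw [mul_pow]
  refine hasSum_le (fun i => ?_) (hasSum_norm_sq_inner b (A x))
    ((hasSum_norm_sq_inner b x).mul_left (C ^ 2))
  rw [inner_apply_of_diagonal b hA, mul_pow]
  exact mul_le_mul_of_nonneg_right (sq_le_sq' (abs_le.1 (ha i)).1 (abs_le.1 (ha i)).2) (sq_nonneg _)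

end EigenSystems
-- Eigenvalue and eigenspace perturbation; the regularized inverse
section Perturbation

variable {E F : Type*} [NormedAddCommGroup E] [InnerProductSpace ℝ E]
  [NormedAddCommGroup F] [InnerProductSpace ℝ F]

namespace IsEigenSystem

variable {T T' : E →L[ℝ] E} {lam lam' : ℕ → ℝ} {e e' : HilbertBasis ℕ ℝ E}

theorem inner_apply (h : IsEigenSystem T lam e) (j : ℕ) (x : E) :
    inner ℝ (e j) (T x) = lam j * inner ℝ (e j) x :=
  inner_apply_of_diagonal e h.eigen j x

theorem hasSum_inner (h : IsEigenSystem T lam e) (x : E) :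
    HasSum (fun j => lam j * inner ℝ (e j) x ^ 2) (inner ℝ (T x) x) := by
  refine (e.hasSum_inner_mul_inner (T x) x).congr_fun fun j => ?_
  rw [real_inner_comm (e j) (T x), h.inner_apply]
  ring

/-- With `inner_le_mul_norm_sq`, the two Rayleigh quotient bounds behind the Courant-Fischer
principle. -/
theorem mul_norm_sq_le (h : IsEigenSystem T lam e) {j : ℕ} {x : E}
    (hx : ∀ l, j < l → inner ℝ (e l) x = 0) : lam j * ‖x‖ ^ 2 ≤ inner ℝ (T x) x := by
  refine hasSum_le (fun l => ?_) ((hasSum_norm_sq_inner e x).mul_left _) (h.hasSum_inner x)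
  rcases lt_or_ge j l with hl | hl
  · simp [hx l hl]
  · exact mul_le_mul_of_nonneg_right (h.antitone hl) (sq_nonneg _)

theorem inner_le_mul_norm_sq (h : IsEigenSystem T lam e) {j : ℕ} {x : E}
    (hx : ∀ l, l < j → inner ℝ (e l) x = 0) : inner ℝ (T x) x ≤ lam j * ‖x‖ ^ 2 := by
  refine hasSum_le (fun l => ?_) (h.hasSum_inner x) ((hasSum_norm_sq_inner e x).mul_left _)
  rcases lt_or_ge l j with hl | hl
  · simp [hx l hl]
  · exact mul_le_mul_of_nonneg_right (h.antitone hl) (sq_nonneg _)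

theorem eq_inner (h : IsEigenSystem T lam e) (j : ℕ) : lam j = inner ℝ (T (e j)) (e j) := by
  rw [h.eigen, inner_smul_left, real_inner_self_eq_norm_sq, e.orthonormal.1]
  simp

theorem nonneg (h : IsEigenSystem T lam e) (hT : ∀ x, 0 ≤ inner ℝ (T x) x) (j : ℕ) :
    0 ≤ lam j := h.eq_inner j ▸ hT _

theorem lt_of_ne (h : IsEigenSystem T lam e) (hne : ∀ j, lam j ≠ lam (j + 1)) (j : ℕ) :
    lam (j + 1) < lam j :=
  lt_of_le_of_ne (h.antitone j.le_succ) (hne j).symm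

/-- Strict decrease puts each eigenvalue above its successor, which is already nonnegative. -/
theorem pos (h : IsEigenSystem T lam e) (hT : ∀ x, 0 ≤ inner ℝ (T x) x)
    (hne : ∀ j, lam j ≠ lam (j + 1)) (j : ℕ) : 0 < lam j :=
  (h.nonneg hT (j + 1)).trans_lt (h.lt_of_ne hne j)

/-- Weyl's perturbation inequality. -/
theorem le_add_norm_sub (h : IsEigenSystem T lam e) (h' : IsEigenSystem T' lam' e') {δ : ℝ}
    (hδ : ‖T' - T‖ ≤ δ) (j : ℕ) : lam j ≤ lam' j + δ := by
  -- Dimension count: `j` linear conditions on `j + 1` coefficients leave a nonzero v in the span of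
  -- e_0, …, e_j orthogonal to e'_0, …, e'_{j-1}. The two Rayleigh bounds are then compared at v.
  let φ : (Fin (j + 1) → ℝ) →ₗ[ℝ] (Fin j → ℝ) :=
    LinearMap.pi fun i => (innerSL ℝ (e' i)).toLinearMap ∘ₗ
      Fintype.linearCombination ℝ fun l : Fin (j + 1) => e l
  obtain ⟨a, ha, ha0⟩ := (LinearMap.ker φ).exists_mem_ne_zero_of_ne_bot
    (LinearMap.ker_ne_bot_of_finrank_lt (by simp))
  set v : E := ∑ l : Fin (j + 1), a l • e l with hv
  have hφ : ∀ i : Fin j, inner ℝ (e' i) v = 0 := fun i => by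
    have := congrFun (LinearMap.mem_ker.1 ha) i
    simpa [φ, Fintype.linearCombination_apply] using this
  have hin : ∀ l : Fin (j + 1), inner ℝ (e l) v = a l := fun l => by
    have : Orthonormal ℝ fun l : Fin (j + 1) => e l :=
      e.orthonormal.comp _ Fin.val_injective
    exact this.inner_right_fintype a l
  have hv0 : v ≠ 0 := by
    intro h0
    apply ha0
    ext l
    rw [← hin l, h0]
    simp
  have hout : ∀ l, j < l → inner ℝ (e l) v = 0 := fun l hl => by
    rw [hv, inner_sum]
    refine Finset.sum_eq_zero fun i _ => ?_
    rw [inner_smul_right, e.orthonormal.2 (by have := i.2; omega), mul_zero]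
  have h1 := h.mul_norm_sq_le hout
  have h2 := h'.inner_le_mul_norm_sq (j := j) (x := v) fun l hl => hφ ⟨l, hl⟩
  have h3 : inner ℝ (T v) v - inner ℝ (T' v) v ≤ δ * ‖v‖ ^ 2 := by
    rw [← inner_sub_left]
    calc inner ℝ (T v - T' v) v ≤ ‖T v - T' v‖ * ‖v‖ := real_inner_le_norm _ _
      _ = ‖(T' - T) v‖ * ‖v‖ := by rw [norm_sub_rev]; rfl
      _ ≤ δ * ‖v‖ * ‖v‖ := by gcongr; exact (T' - T).le_of_opNorm_le hδ v
      _ = _ := by ring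
  have : 0 < ‖v‖ ^ 2 := by positivity
  nlinarith

end IsEigenSystem

variable [CompleteSpace E]

/-- One half of the Davis-Kahan theorem: an eigenspace of `T'` above the gap is almost orthogonal
to the eigenspace of `T` below the gap. -/
theorem norm_one_sub_projFirst_comp_le {T T' : E →L[ℝ] E} {lam lam' : ℕ → ℝ}
    {e e' : HilbertBasis ℕ ℝ E} (h : IsEigenSystem T lam e) (h' : IsEigenSystem T' lam' e')
    {k : ℕ} {δ g : ℝ} (hg : 0 < g) (hsep : ∀ i j, i < k → k ≤ j → g ≤ lam' i - lam j)
    (hδ : HSBound (T' - T) δ) :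
    ‖(1 - projFirst e k) ∘L projFirst e' k‖ ≤ g⁻¹ * δ := by
  refine (hδ.of_forall_le e' (inv_nonneg.2 hg.le) fun i => ?_).opNorm_le
  rw [inv_mul_eq_div, le_div_iff₀ hg, ContinuousLinearMap.comp_apply, projFirst_apply_basis]
  split_ifs with hi
  swap
  · simp
  refine le_of_sq_le_sq ?_ (norm_nonneg _)
  rw [mul_pow, mul_comm]
  -- For j ≥ k, ⟨e_j, (T' - T) e'_i⟩ = (λ'_i - λ_j) ⟨e_j, e'_i⟩, so the separation bounds each
  -- surviving coefficient.
  refine hasSum_le (fun j => ?_) ((hasSum_norm_sq_inner e _).mul_left _)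
    (hasSum_norm_sq_inner e ((T' - T) (e' i)))
  rw [sub_apply, sub_apply, inner_sub_right,
    inner_sub_right, inner_projFirst, one_apply_eq_self]
  split_ifs with hj
  · rw [sub_self]; simpa using sq_nonneg _
  · rw [h.inner_apply, h'.eigen, inner_smul_right, ← sub_mul, sub_zero, mul_pow]
    gcongr
    exact hsep i j hi (not_lt.1 hj)

/-- The Davis-Kahan theorem for spectral projections. -/
theorem norm_projFirst_sub_le {T T' : E →L[ℝ] E} {lam lam' : ℕ → ℝ}
    {e e' : HilbertBasis ℕ ℝ E} (h : IsEigenSystem T lam e) (h' : IsEigenSystem T' lam' e')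
    {k : ℕ} (hk : 0 < k) {δ : ℝ} (hgap : lam k < lam (k - 1)) (hδ : HSBound (T' - T) δ) :
    ‖projFirst e' k - projFirst e k‖ ≤ 4 * δ / (lam (k - 1) - lam k) := by
  have hg : 0 < lam (k - 1) - lam k := sub_pos.2 hgap
  -- If δ is at least half the gap, the trivial bound 2 suffices. Otherwise Weyl's inequality leaves
  -- half the gap between the two spectra in both directions, whence the constant 4.
  rcases le_or_gt ((lam (k - 1) - lam k) / 2) δ with hδg | hδg
  · calc ‖projFirst e' k - projFirst e k‖ ≤ 1 + 1 :=
        (norm_sub_le _ _).trans (add_le_add (norm_projFirst_le _ _) (norm_projFirst_le _ _))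
      _ ≤ _ := by rw [le_div_iff₀ hg]; linarith
  have hδ' : HSBound (T - T') δ := by simpa using hδ.neg
  have w1 := h.le_add_norm_sub h' hδ.opNorm_le
  have w2 := h'.le_add_norm_sub h hδ'.opNorm_le
  have b1 := norm_one_sub_projFirst_comp_le h h' (k := k) (half_pos hg) (fun i j hi hj => by
    have := h'.antitone (show i ≤ k - 1 by omega)
    have := h.antitone hj
    have := w1 (k - 1)
    linarith) hδ
  have b2 := norm_one_sub_projFirst_comp_le h' h (k := k) (half_pos hg) (fun i j hi hj => by
    have := h.antitone (show i ≤ k - 1 by omega)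
    have := h'.antitone hj
    have := w2 k
    linarith) hδ'
  have hadj : ∀ (b : HilbertBasis ℕ ℝ E), ContinuousLinearMap.adjoint (projFirst b k)
      = projFirst b k := fun b =>
    ((ContinuousLinearMap.eq_adjoint_iff _ _).2 fun x y => inner_projFirst_left b k x y).symm
  have heq : projFirst e' k - projFirst e k = (1 - projFirst e k) ∘L projFirst e' k
      - ContinuousLinearMap.adjoint ((1 - projFirst e' k) ∘L projFirst e k) := by
    rw [ContinuousLinearMap.adjoint_comp, map_sub, hadj, hadj, ContinuousLinearMap.one_def,
      ContinuousLinearMap.adjoint_id, ContinuousLinearMap.sub_comp, ContinuousLinearMap.comp_sub]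
    simp
  rw [heq]
  refine (norm_sub_le _ _).trans ?_
  rw [LinearIsometryEquiv.norm_map]
  refine (add_le_add b1 b2).trans_eq ?_
  field_simp
  ring

/-- The sum is coercive with constant θ. Invertibility is essential because `Ring.inverse` takes the
junk value 0 on non-units. -/
theorem isUnit_add_smul_one {T : E →L[ℝ] E} (hT : ∀ x, 0 ≤ inner ℝ (T x) x) {θ : ℝ} (hθ : 0 < θ) :
    IsUnit (T + θ • (1 : E →L[ℝ] E)) := by
  refine ContinuousLinearMap.isUnit_of_forall_le_norm_inner_map _ (c := ⟨θ, hθ.le⟩) hθ fun x => ?_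
  rw [add_apply, inner_add_left, smul_apply,
    inner_smul_left, one_apply_eq_self, real_inner_self_eq_norm_sq]
  refine le_trans ?_ (le_abs_self _)
  have := hT x
  change ‖x‖ ^ 2 * θ ≤ inner ℝ (T x) x + θ * ‖x‖ ^ 2
  linarith

/-- Error of the estimator `D (T' + θ)⁻¹ Π'` of `S` if `D` is close to `S T'`. -/
theorem HSBound.regularized_inverse_sub [CompleteSpace F] {T T' : E →L[ℝ] E} {lam lam' : ℕ → ℝ}
    {e e' : HilbertBasis ℕ ℝ E} (h : IsEigenSystem T lam e) (h' : IsEigenSystem T' lam' e')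
    (hT' : ∀ x, 0 ≤ inner ℝ (T' x) x) {S D : E →L[ℝ] F} {k : ℕ} (hk : 0 < k)
    {θ δ r s t : ℝ} (hθ : 0 < θ) (hpos : 0 < lam (k - 1)) (hgap : lam k < lam (k - 1))
    (hδ : HSBound (T' - T) δ) (hδlam : δ ≤ lam (k - 1) / 2) (hr : HSBound (D - S ∘L T') r)
    (hs : HSBound S s) (ht : HSBound (S - S ∘L projFirst e k) t) :
    HSBound (D ∘L Ring.inverse (T' + θ • 1) ∘L projFirst e' k - S)
      (2 * r / lam (k - 1) + 2 * s * θ / lam (k - 1) + 4 * s * δ / (lam (k - 1) - lam k) + t) := by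
  set U : E →L[ℝ] E := T' + θ • 1 with hU
  have hUu : IsUnit U := isUnit_add_smul_one hT' hθ
  have hl : U ∘L Ring.inverse U = 1 := Ring.mul_inverse_cancel U hUu
  have hr' : Ring.inverse U ∘L U = 1 := Ring.inverse_mul_cancel U hUu
  have hlam' : ∀ j, 0 ≤ lam' j := h'.nonneg hT'
  have hinv : ∀ j, Ring.inverse U (e' j) = (lam' j + θ)⁻¹ • e' j := fun j => by
    have h1 : U (e' j) = (lam' j + θ) • e' j := by
      simp [hU, h'.eigen, add_smul]
    have h2 : Ring.inverse U (U (e' j)) = e' j := by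
      rw [← ContinuousLinearMap.comp_apply, hr']
      rfl
    rw [h1, map_smul] at h2
    rw [eq_inv_smul_iff₀ (by linarith [hlam' j]), h2]
  -- Diagonal in `e'`; by Weyl and `hδlam` the first k perturbed eigenvalues are at least half of
  -- `lam (k - 1)`.
  have hnorm : ‖Ring.inverse U ∘L projFirst e' k‖ ≤ 2 / lam (k - 1) := by
    refine norm_le_of_diagonal e' (a := fun j => if j < k then (lam' j + θ)⁻¹ else 0) (fun j => ?_)
      (by positivity) fun j => ?_
    · rw [ContinuousLinearMap.comp_apply, projFirst_apply_basis]
      split_ifs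
      · exact hinv j
      · simp
    · split_ifs with hj
      · have h1 := h.le_add_norm_sub h' hδ.opNorm_le (k - 1)
        have h2 := h'.antitone (show j ≤ k - 1 by omega)
        rw [abs_of_nonneg (inv_nonneg.2 (by linarith [hlam' j])), ← inv_div]
        exact inv_anti₀ (by linarith) (by linarith)
      · simp only [abs_zero]; positivity
  have hP := norm_projFirst_sub_le h h' hk hgap hδ
  -- Residual, regularization bias, rotation of the eigenspace, and truncation.
  have key : D ∘L Ring.inverse U ∘L projFirst e' k - S
      = (D - S ∘L T') ∘L (Ring.inverse U ∘L projFirst e' k)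
        - (θ • S) ∘L (Ring.inverse U ∘L projFirst e' k)
        + S ∘L (projFirst e' k - projFirst e k) - (S - S ∘L projFirst e k) := by
    ext x
    have hx : T' (Ring.inverse U (projFirst e' k x))
        = projFirst e' k x - θ • Ring.inverse U (projFirst e' k x) := by
      have := congrArg (fun A : E →L[ℝ] E => A (projFirst e' k x)) hl
      simp only [hU, ContinuousLinearMap.comp_apply, add_apply,
        smul_apply, one_apply_eq_self] at this
      exact eq_sub_of_add_eq this
    simp only [sub_apply, add_apply,
      ContinuousLinearMap.comp_apply, smul_apply, hx, map_sub, map_smul]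
    abel
  rw [key]
  refine ((((hr.comp_right _ hnorm).sub ((hs.smul hθ.le).comp_right _ hnorm)).add
    (hs.comp_right _ hP)).sub ht).mono (le_of_eq ?_)
  ring

/-- Truncating a Sobolev operator. -/
theorem HSBound.sub_comp_projFirst [CompleteSpace F] (S : E →L[ℝ] F) (c : HilbertBasis ℕ ℝ E)
    (d : HilbertBasis ℕ ℝ F) {s : ℝ} (hs : 0 < s) {k : ℕ} (hk : 0 < k) {B : ℝ≥0}
    (hB : sobolevTail S c d s k ≤ B) :
    HSBound (S - S ∘L projFirst c k) ((k : ℝ) ^ (-s) * Real.sqrt B) := by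
  have hk' : (0 : ℝ) < k := by exact_mod_cast hk
  refine ⟨by positivity, ?_⟩
  have h1 : ∀ i, ENNReal.ofReal ((k : ℝ) ^ (2 * s)) * ‖(S - S ∘L projFirst c k) (c i)‖ₑ ^ 2 ≤
      ∑' j, if k < max (i + 1) (j + 1) then sobolevTerm S c d s i j else 0 := fun i => by
    rw [sub_apply, ContinuousLinearMap.comp_apply, projFirst_apply_basis]
    split_ifs with hi
    · simp
    rw [map_zero, sub_zero, enorm_sq_eq_tsum d, ← ENNReal.tsum_mul_left]
    refine ENNReal.tsum_le_tsum fun j => ?_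
    -- Here i ≥ k, so number i + 1 exceeds k and the term belongs to the tail for every j; its
    -- weight is at least k^(2s).
    rw [if_pos (lt_max_of_lt_left (by omega)), sobolevTerm, hsInner_tensor, ← ofReal_norm,
      ← ENNReal.ofReal_pow (norm_nonneg _), ← ENNReal.ofReal_mul (by positivity),
      Real.norm_eq_abs, sq_abs, real_inner_comm, mul_comm]
    refine ENNReal.ofReal_le_ofReal (mul_le_mul_of_nonneg_left ?_ (sq_nonneg _))
    have : (k : ℝ) ^ (2 * s) ≤ ((i : ℝ) + 1) ^ (2 * s) :=
      Real.rpow_le_rpow hk'.le (by exact_mod_cast (by omega : k ≤ i + 1)) (by positivity)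
    have : 0 ≤ ((j : ℝ) + 1) ^ (2 * s) := by positivity
    linarith
  have h2 : ENNReal.ofReal ((k : ℝ) ^ (2 * s)) * hsENorm (S - S ∘L projFirst c k) ^ 2 ≤ B := by
    rw [hsENorm_sq c, ← ENNReal.tsum_mul_left]
    exact (ENNReal.tsum_le_tsum h1).trans hB
  rw [← ENNReal.pow_le_pow_left_iff two_ne_zero, ← ENNReal.ofReal_pow (by positivity), mul_pow,
    Real.sq_sqrt B.coe_nonneg, ENNReal.ofReal_mul (by positivity), ENNReal.ofReal_coe_nnreal,
    ← Real.rpow_natCast, ← Real.rpow_mul hk'.le]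
  calc hsENorm (S - S ∘L projFirst c k) ^ 2
      = ENNReal.ofReal ((k : ℝ) ^ (-s * (2 : ℕ))) *
        (ENNReal.ofReal ((k : ℝ) ^ (2 * s)) * hsENorm (S - S ∘L projFirst c k) ^ 2) := by
        rw [← mul_assoc, ← ENNReal.ofReal_mul (by positivity), ← Real.rpow_add hk']
        have : -s * (2 : ℕ) + 2 * s = 0 := by push_cast; ring
        rw [this]
        simp
    _ ≤ _ := by gcongr

end Perturbation

/-! ### Components and row operators on H^L -/

section Lags

variable {H : Type*} [NormedAddCommGroup H] [InnerProductSpace ℝ H]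

/-- The embedding of `H` into `H^L` as the `j`-th component, `j = 1, …, L`. -/
noncomputable def lagEmbed (H : Type*) [NormedAddCommGroup H] [InnerProductSpace ℝ H] (L j : ℕ) :
    H →L[ℝ] Lag H L :=
  ((PiLp.continuousLinearEquiv 2 ℝ fun _ : Fin L => H).symm : (Fin L → H) →L[ℝ] Lag H L) ∘L
    ContinuousLinearMap.pi fun i : Fin L =>
      if (i : ℕ) + 1 = j then ContinuousLinearMap.id ℝ H else 0

theorem component_eq {L : ℕ} (A : Lag H L →L[ℝ] H) (j : ℕ) :
    component A j = A ∘L lagEmbed H L j := rfl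

theorem lagEmbed_apply (L j : ℕ) (x : H) (i : Fin L) :
    lagEmbed H L j x i = if (i : ℕ) + 1 = j then x else 0 := by
  rw [show lagEmbed H L j x i = (if (i : ℕ) + 1 = j then ContinuousLinearMap.id ℝ H else 0) x
    from rfl]
  split_ifs <;> rfl

theorem norm_lagEmbed_le (L j : ℕ) : ‖lagEmbed H L j‖ ≤ 1 := by
  refine ContinuousLinearMap.opNorm_le_bound _ zero_le_one fun x => ?_
  rw [one_mul]
  refine le_of_sq_le_sq ?_ (norm_nonneg x)
  rw [PiLp.norm_sq_eq_of_L2]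
  simp_rw [lagEmbed_apply]
  by_cases h : ∃ i : Fin L, (i : ℕ) + 1 = j
  · obtain ⟨i, rfl⟩ := h
    rw [Finset.sum_eq_single i]
    · simp
    · intro b _ hb
      rw [if_neg (fun h => hb (Fin.ext (by omega)))]
      simp
    · simp
  · rw [Finset.sum_eq_zero fun i _ => by rw [if_neg (fun hi => h ⟨i, hi⟩)]; simp]
    positivity

theorem component_sub {L : ℕ} (A B : Lag H L →L[ℝ] H) (j : ℕ) :
    component (A - B) j = component A j - component B j := rfl

theorem rowOp_apply (ψ : ℕ → H →L[ℝ] H) (L : ℕ) (x : Lag H L) :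
    rowOp ψ L x = ∑ i : Fin L, ψ (i + 1) (x i) := by
  simp [rowOp]

theorem component_rowOp (ψ : ℕ → H →L[ℝ] H) {L j : ℕ} (hj : j < L) :
    component (rowOp ψ L) (j + 1) = ψ (j + 1) := by
  ext x
  rw [component_eq, ContinuousLinearMap.comp_apply, rowOp_apply,
    Finset.sum_eq_single ⟨j, hj⟩ _ (by simp)]
  · rw [lagEmbed_apply, if_pos rfl]
  · intro i _ hi
    rw [lagEmbed_apply, if_neg (fun h => hi (Fin.ext (by simpa using h))), map_zero]

variable [CompleteSpace H]

theorem HSBound.component {L : ℕ} {A : Lag H L →L[ℝ] H} {r : ℝ} (hA : HSBound A r) (j : ℕ) :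
    HSBound (component A j) r := by
  simpa [component_eq] using hA.comp_right _ (norm_lagEmbed_le L j)

theorem adjoint_rowOp_apply (ψ : ℕ → H →L[ℝ] H) (L : ℕ) (y : H) (i : Fin L) :
    ContinuousLinearMap.adjoint (rowOp ψ L) y i = ContinuousLinearMap.adjoint (ψ (i + 1)) y := by
  have : ContinuousLinearMap.adjoint (rowOp ψ L) y
      = WithLp.toLp 2 fun i : Fin L => ContinuousLinearMap.adjoint (ψ (i + 1)) y := by
    refine ext_inner_right ℝ fun v => ?_
    rw [ContinuousLinearMap.adjoint_inner_left, rowOp_apply, inner_sum, PiLp.inner_apply]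
    exact Finset.sum_congr rfl fun i _ => (ContinuousLinearMap.adjoint_inner_left _ _ _).symm
  rw [this]

/-- The adjoint of a row is the column of adjoints, whose squared norm in H^L is a sum over
coordinates. -/
theorem hsENorm_rowOp_sq (ψ : ℕ → H →L[ℝ] H) (L : ℕ) :
    hsENorm (rowOp ψ L) ^ 2 = ∑ i : Fin L, hsENorm (ψ (i + 1)) ^ 2 := by
  simp_rw [← hsENorm_adjoint (rowOp ψ L), ← hsENorm_adjoint (ψ _), hsENorm_sq (onb H)]
  rw [← Summable.tsum_finsetSum fun _ _ => ENNReal.summable]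
  refine tsum_congr fun j => ?_
  have (x : H) : ‖x‖ₑ ^ 2 = ENNReal.ofReal (‖x‖ ^ 2) := by
    rw [ENNReal.ofReal_pow (norm_nonneg _), ofReal_norm]
  simp_rw [← adjoint_rowOp_apply, this]
  rw [← ofReal_norm, ← ENNReal.ofReal_pow (norm_nonneg _), PiLp.norm_sq_eq_of_L2,
    ENNReal.ofReal_sum_of_nonneg fun _ _ => by positivity]

theorem exists_hsBound_rowOp {ψ : ℕ → H →L[ℝ] H}
    (hψ : ∑' i : ℕ, hsENorm (ψ (i + 1)) ^ 2 < ∞) : ∃ s, ∀ L, HSBound (rowOp ψ L) s := by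
  refine ⟨Real.sqrt (∑' i : ℕ, hsENorm (ψ (i + 1)) ^ 2).toReal, fun L => ⟨Real.sqrt_nonneg _, ?_⟩⟩
  rw [← ENNReal.pow_le_pow_left_iff two_ne_zero, ← ENNReal.ofReal_pow (Real.sqrt_nonneg _),
    Real.sq_sqrt ENNReal.toReal_nonneg, ENNReal.ofReal_toReal hψ.ne, hsENorm_rowOp_sq,
    Finset.sum_range (fun i => hsENorm (ψ (i + 1)) ^ 2) |>.symm]
  exact ENNReal.sum_le_tsum _

end Lags

/-! ### Cross-moment operators of square-integrable variables -/

section CrossMoments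

variable {H G G' Ω : Type*} [NormedAddCommGroup H] [InnerProductSpace ℝ H]
  [NormedAddCommGroup G] [InnerProductSpace ℝ G] [NormedAddCommGroup G'] [InnerProductSpace ℝ G']
  [MeasurableSpace Ω] {μ : Measure Ω}

theorem tensor_apply (x : H) (y : G) (v : H) : tensor x y v = inner ℝ x v • y := by
  simp [tensor]

theorem norm_tensor (x : H) (y : G) : ‖tensor x y‖ = ‖x‖ * ‖y‖ := by
  simp [tensor, mul_comm]

theorem continuous_tensor : Continuous fun p : H × G => tensor p.1 p.2 := by
  have h : (fun p : H × G => tensor p.1 p.2)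
      = fun p => ContinuousLinearMap.smulRightL ℝ H G (innerSL ℝ p.1) p.2 := rfl
  rw [h]
  exact ((ContinuousLinearMap.smulRightL ℝ H G).continuous.comp
    ((innerSL ℝ).continuous.comp continuous_fst)).clm_apply continuous_snd

theorem eLpNorm_tensor_le {U : Ω → H} {Y : Ω → G} (hU : MemLp U 2 μ) (hY : MemLp Y 2 μ) :
    eLpNorm (fun ω => tensor (U ω) (Y ω)) 1 μ ≤ eLpNorm U 2 μ * eLpNorm Y 2 μ := by
  have h := eLpNorm_smul_le_mul_eLpNorm (p := 2) (q := 2) (r := 1) hY.1 hU.norm.1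
  rw [eLpNorm_norm] at h
  refine le_trans (le_of_eq (eLpNorm_congr_norm_ae (ae_of_all _ fun ω => ?_))) h
  simp [norm_tensor, norm_smul]

theorem aestronglyMeasurable_tensor {U : Ω → H} {Y : Ω → G} (hU : AEStronglyMeasurable U μ)
    (hY : AEStronglyMeasurable Y μ) : AEStronglyMeasurable (fun ω => tensor (U ω) (Y ω)) μ :=
  Continuous.comp_aestronglyMeasurable (g := fun p : H × G => tensor p.1 p.2)
    (f := fun ω => (U ω, Y ω)) continuous_tensor (hU.prodMk hY)

theorem integrable_tensor {U : Ω → H} {Y : Ω → G} (hU : MemLp U 2 μ) (hY : MemLp Y 2 μ) :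
    Integrable (fun ω => tensor (U ω) (Y ω)) μ := by
  refine ⟨aestronglyMeasurable_tensor hU.1 hY.1, ?_⟩
  have h := (eLpNorm_tensor_le hU hY).trans_lt (ENNReal.mul_lt_top hU.2 hY.2)
  rwa [eLpNorm_one_eq_lintegral_enorm] at h

theorem integral_norm_tensor_le {U : Ω → H} {Y : Ω → G} (hU : MemLp U 2 μ) (hY : MemLp Y 2 μ) :
    ∫ ω, ‖tensor (U ω) (Y ω)‖ ∂μ ≤ (eLpNorm U 2 μ * eLpNorm Y 2 μ).toReal := by
  rw [integral_norm_eq_lintegral_enorm (integrable_tensor hU hY).1, ← eLpNorm_one_eq_lintegral_enorm]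
  exact ENNReal.toReal_mono (ENNReal.mul_lt_top hU.2 hY.2).ne (eLpNorm_tensor_le hU hY)

/-- The cross-moment operator `E X ⊗ Y`. -/
noncomputable def crossMoment (μ : Measure Ω) (U : Ω → H) (Y : Ω → G) : H →L[ℝ] G :=
  ∫ ω, tensor (U ω) (Y ω) ∂μ

theorem crossCov_eq_crossMoment {U : Ω → H} {Y : Ω → G} (hU : ∫ ω, U ω ∂μ = 0)
    (hY : ∫ ω, Y ω ∂μ = 0) : crossCov μ U Y = crossMoment μ U Y := by
  simp [crossCov, crossMoment, hU, hY]

theorem crossMoment_apply [CompleteSpace G] {U : Ω → H} {Y : Ω → G} (hU : MemLp U 2 μ)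
    (hY : MemLp Y 2 μ) (v : H) :
    crossMoment μ U Y v = ∫ ω, inner ℝ (U ω) v • Y ω ∂μ := by
  rw [crossMoment, ContinuousLinearMap.integral_apply (integrable_tensor hU hY)]
  simp only [tensor_apply]

theorem inner_crossMoment [CompleteSpace G] {U : Ω → H} {Y : Ω → G} (hU : MemLp U 2 μ)
    (hY : MemLp Y 2 μ) (v : H) (w : G) :
    inner ℝ (crossMoment μ U Y v) w = ∫ ω, inner ℝ (U ω) v * inner ℝ (Y ω) w ∂μ := by
  have hint : Integrable (fun ω => inner ℝ (U ω) v • Y ω) μ := by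
    simpa only [tensor_apply] using (integrable_tensor hU hY).apply_continuousLinearMap v
  rw [crossMoment_apply hU hY, real_inner_comm, ← integral_inner hint]
  simp only [inner_smul_right, real_inner_comm]

theorem adjoint_crossMoment [CompleteSpace H] [CompleteSpace G] {U : Ω → H} {Y : Ω → G}
    (hU : MemLp U 2 μ) (hY : MemLp Y 2 μ) :
    ContinuousLinearMap.adjoint (crossMoment μ U Y) = crossMoment μ Y U := by
  symm
  rw [ContinuousLinearMap.eq_adjoint_iff]
  intro v w
  rw [inner_crossMoment hY hU, real_inner_comm, inner_crossMoment hU hY]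
  simp only [mul_comm]

theorem comp_crossMoment [CompleteSpace G] [CompleteSpace G'] (A : G →L[ℝ] G') {U : Ω → H}
    {Y : Ω → G} (hU : MemLp U 2 μ) (hY : MemLp Y 2 μ) :
    A ∘L crossMoment μ U Y = crossMoment μ U fun ω => A (Y ω) := by
  ext v
  have hint : Integrable (fun ω => inner ℝ (U ω) v • Y ω) μ := by
    simpa only [tensor_apply] using (integrable_tensor hU hY).apply_continuousLinearMap v
  rw [ContinuousLinearMap.comp_apply, crossMoment_apply hU hY,
    crossMoment_apply (Y := fun ω => A (Y ω)) hU (A.comp_memLp' hY), ← A.integral_comp_comm hint]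
  simp

theorem crossMoment_sub {U : Ω → H} {Y Y' : Ω → G} (hU : MemLp U 2 μ) (hY : MemLp Y 2 μ)
    (hY' : MemLp Y' 2 μ) :
    crossMoment μ U (fun ω => Y ω - Y' ω) = crossMoment μ U Y - crossMoment μ U Y' := by
  rw [crossMoment, crossMoment, crossMoment,
    ← integral_sub (integrable_tensor hU hY) (integrable_tensor hU hY')]
  refine integral_congr_ae (ae_of_all _ fun ω => ?_)
  simp [tensor]

theorem crossMoment_zero (U : Ω → H) : crossMoment μ U (fun _ => (0 : G)) = 0 := by
  simp [crossMoment, tensor]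

/-- Cross moments with a series. -/
theorem hasSum_crossMoment [CompleteSpace G] [CompleteSpace G'] {U : Ω → H} (hU : MemLp U 2 μ)
    {A : ℕ → G →L[ℝ] G'} (hA : Summable fun j => ‖A j‖) {Z : ℕ → Ω → G} {Y : Ω → G'}
    (hZ : ∀ j, MemLp (Z j) 2 μ) {C : ℝ≥0∞} (hC : C ≠ ∞) (hZC : ∀ j, eLpNorm (Z j) 2 μ ≤ C)
    (hY : ∀ᵐ ω ∂μ, HasSum (fun j => A j (Z j ω)) (Y ω)) :
    HasSum (fun j => A j ∘L crossMoment μ U (Z j)) (crossMoment μ U Y) := by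
  have h := hasSum_integral_of_summable_integral_norm (μ := μ)
    (F := fun j ω => tensor (U ω) (A j (Z j ω)))
    (fun j => integrable_tensor hU ((A j).comp_memLp' (hZ j))) ?_
  · have hlim : crossMoment μ U Y = ∫ ω, ∑' j, tensor (U ω) (A j (Z j ω)) ∂μ := by
      refine integral_congr_ae (hY.mono fun ω hω => ?_)
      exact (hω.mapL (InnerProductSpace.rankOne ℝ |>.flip (U ω))).tsum_eq.symm
    rw [hlim]
    simp_rw [comp_crossMoment _ hU (hZ _)]
    exact h
  · refine Summable.of_nonneg_of_le (fun j => integral_nonneg fun ω => norm_nonneg _) (fun j => ?_)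
      (hA.mul_right (eLpNorm U 2 μ * C).toReal)
    calc ∫ ω, ‖tensor (U ω) (A j (Z j ω))‖ ∂μ ≤ ∫ ω, ‖A j‖ * ‖tensor (U ω) (Z j ω)‖ ∂μ := by
          refine integral_mono (integrable_tensor hU ((A j).comp_memLp' (hZ j))).norm
            ((integrable_tensor hU (hZ j)).norm.const_mul _) fun ω => ?_
          simp only [norm_tensor]
          calc ‖U ω‖ * ‖A j (Z j ω)‖ ≤ ‖U ω‖ * (‖A j‖ * ‖Z j ω‖) := by
                gcongr; exact (A j).le_opNorm _
            _ = _ := by ring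
      _ = ‖A j‖ * ∫ ω, ‖tensor (U ω) (Z j ω)‖ ∂μ := integral_const_mul _ _
      _ ≤ ‖A j‖ * (eLpNorm U 2 μ * C).toReal := by
          gcongr
          refine (integral_norm_tensor_le hU (hZ j)).trans (ENNReal.toReal_mono
            (ENNReal.mul_lt_top hU.2 hC.lt_top).ne ?_)
          gcongr
          exact hZC j

/-- Minkowski for the partial sums, then Fatou. Almost sure convergence is enough, with no
summability in L^p. -/
theorem eLpNorm_le_tsum_of_hasSum {B : Type*} [NormedAddCommGroup B] {f : ℕ → Ω → B} {Y : Ω → B} {p : ℝ≥0∞} (hp : 1 ≤ p)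
    (hf : ∀ j, AEStronglyMeasurable (f j) μ) (hY : ∀ᵐ ω ∂μ, HasSum (fun j => f j ω) (Y ω)) :
    eLpNorm Y p μ ≤ ∑' j, eLpNorm (f j) p μ := by
  refine (Lp.eLpNorm_lim_le_liminf_eLpNorm (f := fun n => ∑ j ∈ Finset.range n, f j)
    (fun n => Finset.aestronglyMeasurable_sum _ fun j _ => hf j) Y ?_).trans ?_
  · filter_upwards [hY] with ω hω
    simpa using hω.tendsto_sum_nat
  · refine liminf_le_of_le (by isBoundedDefault) fun b hb => ?_
    obtain ⟨n, hn⟩ := hb.exists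
    exact hn.trans ((eLpNorm_sum_le (fun j _ => hf j) hp).trans (ENNReal.sum_le_tsum _))

theorem eLpNorm_clm_apply_le (A : G →L[ℝ] G') (Z : Ω → G) (p : ℝ≥0∞) :
    eLpNorm (fun ω => A (Z ω)) p μ ≤ ‖A‖ₑ * eLpNorm Z p μ := by
  rw [enorm_eq_nnnorm]
  exact eLpNorm_le_nnreal_smul_eLpNorm_of_ae_le_mul
    (ae_of_all _ fun ω => A.le_opNNNorm _) p

theorem eLpNorm_two_sq {B : Type*} [NormedAddCommGroup B] (Z : Ω → B) : eLpNorm Z 2 μ ^ 2 = ∫⁻ ω, ‖Z ω‖ₑ ^ 2 ∂μ := by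
  simpa using eLpNorm_nnreal_pow_eq_lintegral (f := Z) (μ := μ) (p := 2) two_ne_zero

/-- Cauchy-Schwarz for each E ⟨U, b_i⟩ Y, then Parseval for U. The countable basis allows sum and
integral to be exchanged. -/
theorem hsENorm_crossMoment_le [CompleteSpace H] [CompleteSpace G] (b : HilbertBasis ℕ ℝ H)
    {U : Ω → H} {Y : Ω → G} (hU : MemLp U 2 μ) (hY : MemLp Y 2 μ) :
    hsENorm (crossMoment μ U Y) ≤ eLpNorm U 2 μ * eLpNorm Y 2 μ := by
  rw [← ENNReal.pow_le_pow_left_iff two_ne_zero, mul_pow, hsENorm_sq b, eLpNorm_two_sq U]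
  have hb : ∀ i, MemLp (fun ω => inner ℝ (b i) (U ω)) 2 μ := fun i => hU.const_inner (b i)
  simp_rw [enorm_sq_eq_tsum b]
  rw [lintegral_tsum fun i => (hb i).1.enorm.pow_const 2, ← ENNReal.tsum_mul_right]
  refine ENNReal.tsum_le_tsum fun i => ?_
  rw [← eLpNorm_two_sq, ← mul_pow]
  gcongr
  rw [crossMoment_apply hU hY]
  refine (enorm_integral_le_lintegral_enorm _).trans ?_
  rw [← eLpNorm_one_eq_lintegral_enorm]
  simp only [real_inner_comm (b i)]
  exact eLpNorm_smul_le_mul_eLpNorm (p := 2) (q := 2) (r := 1) hY.1 (hb i).1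

end CrossMoments

/-! ### Lagged vectors: coordinates, positivity, norms -/

section LagVectorsPathwise

variable {H Ω : Type*} [NormedAddCommGroup H] [InnerProductSpace ℝ H]

theorem lagVec_eq_sum (X : ℤ → Ω → H) (L : ℕ) (k : ℤ) (ω : Ω) :
    lagVec X L k ω = ∑ i : Fin L, lagEmbed H L (i + 1) (X (k - (i : ℕ)) ω) := by
  ext j
  rw [WithLp.ofLp_sum, Finset.sum_apply, Finset.sum_eq_single j]
  · rw [lagEmbed_apply, if_pos rfl]
    rfl
  · intro i _ hi
    rw [lagEmbed_apply, if_neg fun h => hi (Fin.ext (by omega))]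
  · simp

theorem inner_lagVec (X : ℤ → Ω → H) (L : ℕ) (k : ℤ) (ω : Ω) (u : Lag H L) :
    inner ℝ (lagVec X L k ω) u = ∑ i : Fin L, inner ℝ (X (k - (i : ℕ)) ω) (u i) := by
  rw [PiLp.inner_apply]
  rfl

theorem empCov_nonneg (X : ℤ → Ω → H) {L N : ℕ} (hLN : L ≤ N) (ω : Ω) (x : Lag H L) :
    0 ≤ inner ℝ (empCov X L N ω x) x := by
  have h : (0 : ℝ) ≤ (N : ℝ) - L + 1 := by
    have : (L : ℝ) ≤ N := by exact_mod_cast hLN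
    linarith
  rw [empCov, smul_apply, inner_smul_left, sum_apply, sum_inner]
  refine mul_nonneg (by simpa using h) (Finset.sum_nonneg fun k _ => ?_)
  rw [tensor_apply, inner_smul_left]
  exact mul_self_nonneg _

end LagVectorsPathwise

theorem eLpNorm_lagVec_le {H Ω : Type*} [NormedAddCommGroup H] [MeasurableSpace Ω]
    {μ : Measure Ω} {X : ℤ → Ω → H} (hX : ∀ k, MemLp (X k) 2 μ) {s : ℝ≥0∞}
    (hs : ∀ k, eLpNorm (X k) 2 μ ≤ s) (L : ℕ) (k : ℤ) :
    eLpNorm (lagVec X L k) 2 μ ≤ ENNReal.ofReal (Real.sqrt L) * s := by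
  have hn (x : H) : ‖x‖ₑ ^ 2 = ENNReal.ofReal (‖x‖ ^ 2) := by
    rw [ENNReal.ofReal_pow (norm_nonneg _), ofReal_norm]
  have h (ω : Ω) : ‖lagVec X L k ω‖ₑ ^ 2 = ∑ i : Fin L, ‖X (k - (i : ℕ)) ω‖ₑ ^ 2 := by
    rw [← ofReal_norm, ← ENNReal.ofReal_pow (norm_nonneg _), PiLp.norm_sq_eq_of_L2,
      ENNReal.ofReal_sum_of_nonneg fun _ _ => by positivity]
    simp_rw [hn]
    rfl
  rw [← ENNReal.pow_le_pow_left_iff two_ne_zero, eLpNorm_two_sq, mul_pow,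
    ← ENNReal.ofReal_pow (Real.sqrt_nonneg _), Real.sq_sqrt (Nat.cast_nonneg L)]
  simp_rw [h]
  rw [lintegral_finsetSum' _ fun i _ => (hX _).1.enorm.pow_const 2]
  simp_rw [← eLpNorm_two_sq]
  refine (Finset.sum_le_sum fun i _ => pow_le_pow_left' (hs _) 2).trans ?_
  simp

theorem IsStrictlyStationary.eLpNorm_eq {H Ω : Type*} [NormedAddCommGroup H]
    [MeasurableSpace H] [BorelSpace H] [MeasurableSpace Ω] {μ : Measure Ω}
    {X : ℤ → Ω → H} (hX : IsStrictlyStationary μ X) (p : ℝ≥0∞) (k : ℤ) :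
    eLpNorm (X k) p μ = eLpNorm (X 0) p μ := by
  have h := (hX 1 (fun _ => 0) k).comp (measurable_pi_apply 0)
  simpa [Function.comp_def] using (h.eLpNorm_eq p).symm

/-! ### Second moments of lagged vectors, uniformly in L -/

section LagVectors

variable {H Ω : Type*} [NormedAddCommGroup H] [InnerProductSpace ℝ H] [MeasurableSpace Ω]
  {μ : Measure Ω}

theorem memLp_lagVec {X : ℤ → Ω → H} (hX : ∀ k, MemLp (X k) 2 μ) (L : ℕ) (k : ℤ) :
    MemLp (lagVec X L k) 2 μ := by
  have : lagVec X L k = fun ω => ∑ i : Fin L, lagEmbed H L (i + 1) (X (k - (i : ℕ)) ω) :=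
    funext fun ω => lagVec_eq_sum X L k ω
  rw [this]
  exact memLp_finsetSum _ fun i _ => (lagEmbed H L (i + 1)).comp_memLp' (hX _)

theorem integral_lagVec_eq_zero [CompleteSpace H] [IsFiniteMeasure μ] {X : ℤ → Ω → H}
    (hX : ∀ k, MemLp (X k) 2 μ) (h0 : IsCentered μ X) (L : ℕ) (k : ℤ) :
    ∫ ω, lagVec X L k ω ∂μ = 0 := by
  have hint (i : Fin L) : Integrable (fun ω => lagEmbed H L (i + 1) (X (k - (i : ℕ)) ω)) μ :=
    ((lagEmbed H L (i + 1)).comp_memLp' (hX _)).integrable one_le_two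
  simp_rw [lagVec_eq_sum]
  rw [integral_finsetSum _ fun i _ => hint i]
  refine Finset.sum_eq_zero fun i _ => ?_
  rw [ContinuousLinearMap.integral_comp_comm _ ((hX _).integrable one_le_two), h0, map_zero]

/-- Inner products with the lagged vectors of a causal linear process. -/
theorem hasSum_inner_lagVec {X ε : ℤ → Ω → H} {φ : ℕ → H →L[ℝ] H} [CompleteSpace H]
    (hX : IsCausalLinear μ X ε φ) (L : ℕ) (k : ℤ) (u : Lag H L) :
    ∀ᵐ ω ∂μ, HasSum (fun j : ℕ => inner ℝ (lagVec ε L (k - ((j : ℤ) + 1)) ω)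
      (WithLp.toLp 2 fun i : Fin L => ContinuousLinearMap.adjoint (φ (j + 1)) (u i) : Lag H L))
      (inner ℝ (lagVec X L k ω) u - inner ℝ (lagVec ε L k ω) u) := by
  have := ae_all_iff.2 hX.eq
  filter_upwards [this] with ω hω
  simp_rw [inner_lagVec, ← Finset.sum_sub_distrib, ContinuousLinearMap.adjoint_inner_right]
  refine hasSum_sum fun i _ => ?_
  have h := (hω (k - (i : ℕ))).mapL (innerSL ℝ (u i))
  simp only [innerSL_apply_apply, inner_sub_right] at h
  simp only [real_inner_comm (u i)]
  refine h.congr_fun fun j => ?_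
  rw [show k - ((j : ℤ) + 1) - ((i : ℕ) : ℤ) = k - (i : ℕ) - ((j : ℤ) + 1) by ring]

theorem norm_toLp_le {L : ℕ} (A : H →L[ℝ] H) (u : Lag H L) :
    ‖(WithLp.toLp 2 fun i : Fin L => A (u i) : Lag H L)‖ ≤ ‖A‖ * ‖u‖ := by
  refine le_of_sq_le_sq ?_ (by positivity)
  rw [mul_pow, PiLp.norm_sq_eq_of_L2, PiLp.norm_sq_eq_of_L2, Finset.mul_sum]
  refine Finset.sum_le_sum fun i _ => ?_
  rw [← mul_pow]
  exact pow_le_pow_left₀ (norm_nonneg _) (A.le_opNorm _) 2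

/-- Inner products with lagged vectors of uncorrelated variables. -/
theorem eLpNorm_inner_lagVec_le [CompleteSpace H] {ε : ℤ → Ω → H} (hε : ∀ k, MemLp (ε k) 2 μ)
    {s : ℝ≥0∞} (hs : ∀ k, eLpNorm (ε k) 2 μ ≤ s)
    (hunc : ∀ k l, k ≠ l → crossMoment μ (ε k) (ε l) = 0) (L : ℕ) (k : ℤ) (u : Lag H L) :
    eLpNorm (fun ω => inner ℝ (lagVec ε L k ω) u) 2 μ ≤ s * ‖u‖ₑ := by
  have hm : ∀ i : Fin L, MemLp (fun ω => inner ℝ (ε (k - (i : ℕ)) ω) (u i)) 2 μ :=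
    fun i => (hε _).inner_const _
  have hM : MemLp (fun ω => inner ℝ (lagVec ε L k ω) u) 2 μ := (memLp_lagVec hε L k).inner_const u
  have e2 (y : ℝ) : ENNReal.ofReal (y ^ 2) = ‖y‖ₑ ^ 2 := by
    rw [← sq_abs, ← Real.norm_eq_abs, ENNReal.ofReal_pow (norm_nonneg _), ofReal_norm]
  have hl (f : Ω → ℝ) (hf : MemLp f 2 μ) :
      eLpNorm f 2 μ ^ 2 = ENNReal.ofReal (∫ ω, f ω ^ 2 ∂μ) := by
    rw [eLpNorm_two_sq, ofReal_integral_eq_lintegral_ofReal hf.integrable_sq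
      (ae_of_all _ fun _ => sq_nonneg _)]
    simp_rw [e2]
  -- Uncorrelatedness removes the mixed terms, so the bound carries no factor growing with L.
  have hsum : ∫ ω, inner ℝ (lagVec ε L k ω) u ^ 2 ∂μ
      = ∑ i : Fin L, ∫ ω, inner ℝ (ε (k - (i : ℕ)) ω) (u i) ^ 2 ∂μ := by
    have hint (i j : Fin L) : Integrable (fun ω =>
        inner ℝ (ε (k - (i : ℕ)) ω) (u i) * inner ℝ (ε (k - (j : ℕ)) ω) (u j)) μ :=
      (hm i).integrable_mul (hm j)
    simp_rw [inner_lagVec, sq, Finset.sum_mul_sum]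
    rw [integral_finsetSum _ fun i _ => integrable_finsetSum _ fun j _ => hint i j]
    refine Finset.sum_congr rfl fun i _ => ?_
    rw [integral_finsetSum _ fun j _ => hint i j,
      Finset.sum_eq_single i _ (by simp)]
    intro j _ hj
    rw [← inner_crossMoment (hε _) (hε _), hunc]
    · simp
    · intro h
      exact hj (Fin.ext (by omega))
  rw [← ENNReal.pow_le_pow_left_iff two_ne_zero, hl _ hM, hsum,
    ENNReal.ofReal_sum_of_nonneg fun i _ => integral_nonneg fun _ => sq_nonneg _]
  simp_rw [← hl _ (hm _)]
  rw [mul_pow, ← ofReal_norm u, ← ENNReal.ofReal_pow (norm_nonneg _), PiLp.norm_sq_eq_of_L2,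
    ENNReal.ofReal_sum_of_nonneg fun _ _ => by positivity, Finset.mul_sum]
  refine Finset.sum_le_sum fun i _ => ?_
  rw [ENNReal.ofReal_pow (norm_nonneg _), ofReal_norm, ← mul_pow]
  refine pow_le_pow_left' ?_ 2
  have := eLpNorm_clm_apply_le (μ := μ) (innerSL ℝ (u i)) (ε (k - (i : ℕ))) 2
  simp only [innerSL_apply_apply] at this
  simp only [real_inner_comm (u i)]
  refine this.trans ?_
  rw [mul_comm]
  refine mul_le_mul' (hs _) (le_of_eq ?_)
  rw [← ofReal_norm, innerSL_apply_norm, ofReal_norm]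

/-- The covariance operators of the lagged vectors of a causal linear process are bounded. -/
theorem exists_inner_crossMoment_lagVec_le [CompleteSpace H] {X ε : ℤ → Ω → H}
    {φ : ℕ → H →L[ℝ] H} (hlin : IsCausalLinear μ X ε φ) (hX : ∀ k, MemLp (X k) 2 μ)
    (hε : ∀ k, MemLp (ε k) 2 μ) {s : ℝ≥0∞} (hs0 : s ≠ ∞) (hs : ∀ k, eLpNorm (ε k) 2 μ ≤ s)
    (hunc : ∀ k l, k ≠ l → crossMoment μ (ε k) (ε l) = 0) :
    ∃ B : ℝ, ∀ (L : ℕ) (u : Lag H L), ‖u‖ = 1 →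
      inner ℝ (crossMoment μ (lagVec X L 0) (lagVec X L 0) u) u ≤ B := by
  set Φ : ℝ≥0∞ := ∑' j : ℕ, ‖φ (j + 1)‖ₑ with hΦ
  have hΦt : Φ ≠ ∞ := by
    rw [hΦ]
    exact tsum_enorm_ne_top_iff_summable_norm.2 hlin.summable
  -- The current innovations contribute s and the j-th lag at most s ‖φ_j‖, because φ_j* acts on u
  -- coordinatewise.
  refine ⟨(((s + s * Φ) ^ 2).toReal), fun L u hu => ?_⟩
  have hue : ‖u‖ₑ = 1 := by rw [← ofReal_norm, hu, ENNReal.ofReal_one]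
  have hXL := memLp_lagVec hX L 0
  have hM : MemLp (fun ω => inner ℝ (lagVec X L 0 ω) u) 2 μ := hXL.inner_const u
  have hMε (k : ℤ) (v : Lag H L) : MemLp (fun ω => inner ℝ (lagVec ε L k ω) v) 2 μ :=
    (memLp_lagVec hε L k).inner_const v
  have h1 : eLpNorm (fun ω => inner ℝ (lagVec X L 0 ω) u - inner ℝ (lagVec ε L 0 ω) u) 2 μ
      ≤ s * Φ := by
    refine (eLpNorm_le_tsum_of_hasSum one_le_two (fun j => (hMε _ _).1)
      (hasSum_inner_lagVec hlin L 0 u)).trans ?_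
    rw [hΦ, ← ENNReal.tsum_mul_left]
    refine ENNReal.tsum_le_tsum fun j => (eLpNorm_inner_lagVec_le hε hs hunc L _ _).trans ?_
    gcongr
    have := norm_toLp_le (ContinuousLinearMap.adjoint (φ (j + 1))) u
    rw [hu, mul_one, LinearIsometryEquiv.norm_map] at this
    rw [← ofReal_norm, ← ofReal_norm]
    exact ENNReal.ofReal_le_ofReal this
  have h2 : eLpNorm (fun ω => inner ℝ (lagVec X L 0 ω) u) 2 μ ≤ s + s * Φ := by
    have h3 := eLpNorm_add_le (hMε 0 u).1 (hM.1.sub (hMε 0 u).1) (p := 2) one_le_two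
    have h4 : (fun ω => inner ℝ (lagVec ε L 0 ω) u) + ((fun ω => inner ℝ (lagVec X L 0 ω) u)
        - fun ω => inner ℝ (lagVec ε L 0 ω) u) = fun ω => inner ℝ (lagVec X L 0 ω) u := by
      ext ω
      simp
    rw [h4] at h3
    refine h3.trans (add_le_add ?_ h1)
    simpa [hue] using eLpNorm_inner_lagVec_le hε hs hunc L 0 u
  rw [inner_crossMoment hXL hXL]
  have e2 (y : ℝ) : ENNReal.ofReal (y * y) = ‖y‖ₑ ^ 2 := by
    rw [← sq, ← sq_abs, ← Real.norm_eq_abs, ENNReal.ofReal_pow (norm_nonneg _), ofReal_norm]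
  rw [integral_eq_lintegral_of_nonneg_ae (ae_of_all _ fun _ => mul_self_nonneg _)
    (hM.integrable_mul hM).1]
  simp_rw [e2]
  rw [← eLpNorm_two_sq]
  refine ENNReal.toReal_mono ?_ (pow_le_pow_left' h2 2)
  finiteness

end LagVectors

/-! ### Causality and identifiability of coefficients -/

section Processes

variable {H Ω : Type*} [NormedAddCommGroup H] [InnerProductSpace ℝ H] [CompleteSpace H]
  [MeasurableSpace Ω] {μ : Measure Ω}

/-- The innovations are uncorrelated with the past of a causal process. -/
theorem IsCausalLinear.crossMoment_eq {X ε : ℤ → Ω → H} {φ : ℕ → H →L[ℝ] H}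
    (hlin : IsCausalLinear μ X ε φ) (hX : ∀ k, MemLp (X k) 2 μ)
    (hε : ∀ k, MemLp (ε k) 2 μ) {s : ℝ≥0∞} (hs0 : s ≠ ∞) (hs : ∀ k, eLpNorm (ε k) 2 μ ≤ s)
    (hunc : ∀ k l, k ≠ l → crossMoment μ (ε k) (ε l) = 0) {l m : ℤ} (hlm : l ≤ m) :
    crossMoment μ (ε m) (X l) = crossMoment μ (ε m) (ε l) := by
  have h := hasSum_crossMoment (hε m) hlin.summable (fun j : ℕ => hε (l - ((j : ℤ) + 1))) hs0
    (fun j => hs _) (hlin.eq l)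
  rw [crossMoment_sub (hε m) (hX l) (hε l)] at h
  have h0 : (fun j : ℕ => φ (j + 1) ∘L crossMoment μ (ε m) (ε (l - ((j : ℤ) + 1)))) = 0 := by
    ext1 j
    rw [hunc _ _ (by omega), ContinuousLinearMap.comp_zero]
    rfl
  rw [h0] at h
  exact sub_eq_zero.1 (h.unique hasSum_zero)

/-- Coefficients of a causal process with injective innovation covariance are identifiable. -/
theorem eq_zero_of_hasSum_zero {X ε : ℤ → Ω → H} {χ : ℕ → H →L[ℝ] H}
    (hX : ∀ k, MemLp (X k) 2 μ) (hε : ∀ k, MemLp (ε k) 2 μ) {s : ℝ≥0∞} (hs0 : s ≠ ∞)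
    (hs : ∀ k, eLpNorm (X k) 2 μ ≤ s) {m : ℤ} {C : H →L[ℝ] H}
    (hm : crossMoment μ (ε m) (X m) = C) (hlt : ∀ l < m, crossMoment μ (ε m) (X l) = 0)
    (hC : Function.Injective C) (hCsymm : ContinuousLinearMap.adjoint C = C)
    (hχ : Summable fun j => ‖χ j‖)
    (hsum : ∀ᵐ ω ∂μ, HasSum (fun j : ℕ => χ j (X (m - j) ω)) 0) : χ 0 = 0 := by
  have h := hasSum_crossMoment (Y := fun _ => (0 : H)) (hε m) hχ (fun j : ℕ => hX (m - j)) hs0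
    (fun j => hs _) hsum
  rw [crossMoment_zero] at h
  -- The terms j ≥ 1 involve X before time m, uncorrelated with ε_m; what remains is χ₀ C = 0.
  -- Taking adjoints gives C χ₀* = 0, to which injectivity of C applies.
  have h1 := h.unique (hasSum_single 0 fun j hj => by
    rw [hlt _ (by omega), ContinuousLinearMap.comp_zero])
  simp only [CharP.cast_eq_zero, sub_zero, hm] at h1
  have h2 : C ∘L ContinuousLinearMap.adjoint (χ 0) = 0 := by
    rw [← hCsymm, ← ContinuousLinearMap.adjoint_comp, ← h1, map_zero]
  have h3 : ContinuousLinearMap.adjoint (χ 0) = 0 := by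
    ext x
    apply hC
    simpa using congrArg (fun A : H →L[ℝ] H => A x) h2
  simpa using h3

end Processes

/-! ### The inverted fARMA equation and the Yule-Walker equation -/

section YuleWalker

variable {H Ω : Type*} [NormedAddCommGroup H] [InnerProductSpace ℝ H]
  [MeasurableSpace Ω] {μ : Measure Ω}

/-- The coefficients of the series obtained by inserting the inverted process into the
fARMA(1,1) equation. -/
noncomputable def invertedCoeff (ψ : ℕ → H →L[ℝ] H) (α₁ β₁ : H →L[ℝ] H) : ℕ → H →L[ℝ] H
  | 0 => ψ 1 - α₁ - β₁
  | i + 1 => ψ (i + 2) + β₁ ∘L ψ (i + 1)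

/-- Inversion expresses both X_{m+1} - ε_{m+1} and ε_m through present and past X; substitute these
into the equation at time m + 1 and collect coefficients of X_{m-j}. -/
theorem hasSum_invertedCoeff [MeasurableSpace H] {X ε : ℤ → Ω → H} {α₁ β₁ : H →L[ℝ] H}
    {ψ : ℕ → H →L[ℝ] H} (harma : IsFARMA11 μ X ε α₁ β₁) (hinv : IsInvertible μ X ε ψ) (m : ℤ) :
    ∀ᵐ ω ∂μ, HasSum (fun j : ℕ => invertedCoeff ψ α₁ β₁ j (X (m - j) ω)) 0 := by
  filter_upwards [harma.eq (m + 1), hinv.eq (m + 1), hinv.eq m] with ω h1 h2 h3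
  rw [← hasSum_nat_add_iff' 1] at h2
  rw [← hasSum_nat_add_iff' 1]
  have h4 := h2.add (h3.mapL β₁)
  simp only [Finset.range_one, Finset.sum_singleton, Nat.cast_zero, sub_zero, zero_add,
    add_sub_cancel_right] at h1 h4 ⊢
  convert h4 using 1
  · ext j
    rw [show m + 1 - (((j + 1 : ℕ) : ℤ) + 1) = m - ((j : ℤ) + 1) by push_cast; ring]
    simp [invertedCoeff]
  · rw [h1, invertedCoeff]
    simp only [sub_apply, map_sub]
    abel

theorem summable_norm_invertedCoeff {ψ : ℕ → H →L[ℝ] H} (α₁ β₁ : H →L[ℝ] H)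
    (hψ : Summable fun l : ℕ => ‖ψ (l + 1)‖) :
    Summable fun j => ‖invertedCoeff ψ α₁ β₁ j‖ := by
  rw [← summable_nat_add_iff 1]
  have h1 : Summable fun i : ℕ => ‖ψ (i + 2)‖ :=
    (summable_nat_add_iff (f := fun l => ‖ψ (l + 1)‖) 1).2 hψ
  have h2 : Summable fun i : ℕ => ‖ψ (i + 2)‖ + ‖β₁‖ * ‖ψ (i + 1)‖ := h1.add (hψ.mul_left ‖β₁‖)
  refine h2.of_nonneg_of_le (fun _ => norm_nonneg _) fun i => ?_
  exact (norm_add_le _ _).trans (add_le_add le_rfl (ContinuousLinearMap.opNorm_comp_le _ _))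

variable [CompleteSpace H]

/-- The first two coefficients of the inverted fARMA(1,1) equation. -/
theorem coeff_eq_of_arma [MeasurableSpace H] [BorelSpace H] {X ε : ℤ → Ω → H}
    {α₁ β₁ : H →L[ℝ] H} {ψ φ : ℕ → H →L[ℝ] H} (harma : IsFARMA11 μ X ε α₁ β₁)
    (hlin : IsCausalLinear μ X ε φ) (hinv : IsInvertible μ X ε ψ) (hX : ∀ k, MemLp (X k) 2 μ)
    (hεstat : IsStrictlyStationary μ ε) (hCε : Function.Injective (cov μ (ε 0)))
    (hψ : Summable fun l : ℕ => ‖ψ (l + 1)‖) :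
    ψ 1 = α₁ + β₁ ∧ ψ 2 = -(β₁ ∘L ψ 1) := by
  have hε := harma.whiteNoise.memLp
  have hunc : ∀ k l, k ≠ l → crossMoment μ (ε k) (ε l) = 0 := fun k l hkl => by
    rw [← crossCov_eq_crossMoment (harma.whiteNoise.centered k) (harma.whiteNoise.centered l)]
    exact harma.whiteNoise.uncorrelated k l hkl
  have hcross {l : ℤ} (hl : l ≤ 0) : crossMoment μ (ε 0) (X l) = crossMoment μ (ε 0) (ε l) :=
    hlin.crossMoment_eq hX hε (hε 0).2.ne (fun k => (hεstat.eLpNorm_eq 2 k).le) hunc hl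
  have hcov : cov μ (ε 0) = crossMoment μ (ε 0) (ε 0) :=
    crossCov_eq_crossMoment (harma.whiteNoise.centered 0) (harma.whiteNoise.centered 0)
  rw [hcov] at hCε
  have hzero {χ : ℕ → H →L[ℝ] H} (hχ : Summable fun j => ‖χ j‖)
      (hsum : ∀ᵐ ω ∂μ, HasSum (fun j : ℕ => χ j (X (0 - j) ω)) 0) : χ 0 = 0 :=
    eq_zero_of_hasSum_zero hX hε (hX 0).2.ne (fun k => (hinv.stationary.eLpNorm_eq 2 k).le)
      (hcross le_rfl) (fun l hl => (hcross hl.le).trans (hunc 0 l hl.ne')) hCε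
      (adjoint_crossMoment (hε 0) (hε 0)) hχ hsum
  have hs := summable_norm_invertedCoeff α₁ β₁ hψ
  have h0 : invertedCoeff ψ α₁ β₁ 0 = 0 := hzero hs (hasSum_invertedCoeff harma hinv 0)
  -- With the leading coefficient gone, the series at m = 1 starts at X_0, so pairing with ε_0
  -- isolates the next one.
  have h1 : invertedCoeff ψ α₁ β₁ 1 = 0 := by
    have hs' : Summable fun i : ℕ => ‖invertedCoeff ψ α₁ β₁ (i + 1)‖ :=
      (summable_nat_add_iff (f := fun i => ‖invertedCoeff ψ α₁ β₁ i‖) 1).2 hs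
    refine hzero (χ := fun i => invertedCoeff ψ α₁ β₁ (i + 1)) hs' ?_
    filter_upwards [hasSum_invertedCoeff harma hinv 1] with ω hω
    rw [← hasSum_nat_add_iff' 1] at hω
    simp only [Finset.range_one, Finset.sum_singleton, h0, zero_apply, sub_zero] at hω
    refine hω.congr_fun fun j => ?_
    rw [show (1 : ℤ) - ((j + 1 : ℕ) : ℤ) = 0 - (j : ℤ) by push_cast; ring]
  replace h0 : ψ 1 - α₁ - β₁ = 0 := h0
  replace h1 : ψ 2 + β₁ ∘L ψ 1 = 0 := h1
  exact ⟨by rw [sub_sub] at h0; exact sub_eq_zero.1 h0, eq_neg_of_add_eq_zero_left h1⟩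

theorem crossMoment_lagVec_innovation_eq_zero {X ε : ℤ → Ω → H} {φ : ℕ → H →L[ℝ] H}
    (hlin : IsCausalLinear μ X ε φ) (hX : ∀ k, MemLp (X k) 2 μ)
    (hε : ∀ k, MemLp (ε k) 2 μ) {s : ℝ≥0∞} (hs0 : s ≠ ∞) (hs : ∀ k, eLpNorm (ε k) 2 μ ≤ s)
    (hunc : ∀ k l, k ≠ l → crossMoment μ (ε k) (ε l) = 0) (L : ℕ) :
    crossMoment μ (lagVec X L 0) (ε 1) = 0 := by
  ext v
  have hint (i : Fin L) : Integrable (fun ω => inner ℝ (X (0 - (i : ℕ)) ω) (v i) • ε 1 ω) μ := by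
    simpa only [tensor_apply] using
      (integrable_tensor (hX _) (hε 1)).apply_continuousLinearMap (v i)
  rw [crossMoment_apply (memLp_lagVec hX L 0) (hε 1)]
  simp_rw [inner_lagVec, Finset.sum_smul]
  rw [integral_finsetSum _ fun i _ => hint i, zero_apply]
  refine Finset.sum_eq_zero fun i _ => ?_
  rw [← crossMoment_apply (hX _) (hε 1), ← adjoint_crossMoment (hε 1) (hX _),
    hlin.crossMoment_eq hX hε hs0 hs hunc (by omega), hunc _ _ (by omega)]
  simp

/-- The approximate Yule-Walker equation. -/
theorem hsBound_crossCov_sub_rowOp_comp_cov [MeasurableSpace H] [BorelSpace H]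
    [IsProbabilityMeasure μ] {X ε : ℤ → Ω → H} {ψ φ : ℕ → H →L[ℝ] H} (hwn : IsWhiteNoise μ ε)
    (hlin : IsCausalLinear μ X ε φ) (hinv : IsInvertible μ X ε ψ) (hX : ∀ k, MemLp (X k) 2 μ)
    (hεstat : IsStrictlyStationary μ ε) (hψ : Summable fun l : ℕ => ‖ψ (l + 1)‖)
    (L : ℕ) (b : HilbertBasis ℕ ℝ (Lag H L)) :
    HSBound (crossCov μ (lagVec X L 0) (X 1) - rowOp ψ L ∘L cov μ (lagVec X L 0))
      (Real.sqrt L * (∑' l : ℕ, ‖ψ (L + 1 + l)‖) * (eLpNorm (X 0) 2 μ).toReal ^ 2) := by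
  have hε := hwn.memLp
  have hunc : ∀ k l, k ≠ l → crossMoment μ (ε k) (ε l) = 0 := fun k l hkl => by
    rw [← crossCov_eq_crossMoment (hwn.centered k) (hwn.centered l)]
    exact hwn.uncorrelated k l hkl
  have hU := memLp_lagVec hX L 0
  have hU0 := integral_lagVec_eq_zero hX hinv.centered L 0
  have hΨU : MemLp (fun ω => rowOp ψ L (lagVec X L 0 ω)) 2 μ := (rowOp ψ L).comp_memLp' hU
  set σ := eLpNorm (X 0) 2 μ with hσ
  -- Removing the first L lags and the innovation from X_1 leaves exactly the tail of the inverted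
  -- series.
  have hY : ∀ᵐ ω ∂μ, HasSum (fun j : ℕ => ψ (L + 1 + j) (X (-(L : ℤ) - j) ω))
      (X 1 ω - ε 1 ω - rowOp ψ L (lagVec X L 0 ω)) := by
    filter_upwards [hinv.eq 1] with ω hω
    rw [← hasSum_nat_add_iff' L] at hω
    convert hω using 1
    · ext j
      rw [show L + 1 + j = j + L + 1 by ring,
        show (1 : ℤ) - (((j + L : ℕ) : ℤ) + 1) = -(L : ℤ) - j by push_cast; ring]
    · rw [rowOp_apply, Finset.sum_range fun j : ℕ => ψ (j + 1) (X (1 - ((j : ℤ) + 1)) ω)]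
      congr 1
      refine Finset.sum_congr rfl fun i _ => ?_
      rw [show (1 : ℤ) - (((i : ℕ) : ℤ) + 1) = 0 - ((i : ℕ) : ℤ) by ring]
      rfl
  have hYm : MemLp (fun ω => X 1 ω - ε 1 ω) 2 μ := (hX 1).sub (hε 1)
  have hYm' : MemLp (fun ω => X 1 ω - ε 1 ω - rowOp ψ L (lagVec X L 0 ω)) 2 μ := hYm.sub hΨU
  have heq : crossCov μ (lagVec X L 0) (X 1) - rowOp ψ L ∘L cov μ (lagVec X L 0)
      = crossMoment μ (lagVec X L 0) fun ω => X 1 ω - ε 1 ω - rowOp ψ L (lagVec X L 0 ω) := by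
    rw [crossMoment_sub hU hYm hΨU, crossMoment_sub hU (hX 1) (hε 1),
      crossMoment_lagVec_innovation_eq_zero hlin hX hε (hε 0).2.ne
        (fun k => (hεstat.eLpNorm_eq 2 k).le) hunc, sub_zero, ← comp_crossMoment _ hU hU,
      crossCov_eq_crossMoment hU0 (hinv.centered 1), cov, crossCov_eq_crossMoment hU0 hU0]
  have hψL : Summable fun l : ℕ => ‖ψ (L + 1 + l)‖ := by
    simpa only [add_comm, add_left_comm, add_assoc] using (summable_nat_add_iff L).2 hψ
  have hYn : eLpNorm (fun ω => X 1 ω - ε 1 ω - rowOp ψ L (lagVec X L 0 ω)) 2 μ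
      ≤ ENNReal.ofReal (∑' l : ℕ, ‖ψ (L + 1 + l)‖) * σ := by
    refine (eLpNorm_le_tsum_of_hasSum one_le_two
      (fun j => ((ψ (L + 1 + j)).comp_memLp' (hX _)).1) hY).trans ?_
    rw [ENNReal.ofReal_tsum_of_nonneg (fun _ => norm_nonneg _) hψL, ← ENNReal.tsum_mul_right]
    refine ENNReal.tsum_le_tsum fun j => (eLpNorm_clm_apply_le _ _ _).trans ?_
    rw [hinv.stationary.eLpNorm_eq, ofReal_norm]
  rw [heq]
  have hτ : 0 ≤ ∑' l : ℕ, ‖ψ (L + 1 + l)‖ := tsum_nonneg fun _ => norm_nonneg _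
  refine ⟨by positivity, (hsENorm_crossMoment_le b hU hYm').trans ((mul_le_mul'
    (eLpNorm_lagVec_le hX (fun k => (hinv.stationary.eLpNorm_eq 2 k).le) L 0) hYn).trans_eq ?_)⟩
  rw [ENNReal.ofReal_mul (by positivity), ENNReal.ofReal_mul (by positivity),
    ENNReal.ofReal_pow ENNReal.toReal_nonneg, ENNReal.ofReal_toReal (hX 0).2.ne]
  ring

theorem cov_lagVec_eq [IsProbabilityMeasure μ] {X : ℤ → Ω → H} (hX : ∀ k, MemLp (X k) 2 μ)
    (h0 : IsCentered μ X) (L : ℕ) :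
    cov μ (lagVec X L 0) = crossMoment μ (lagVec X L 0) (lagVec X L 0) :=
  crossCov_eq_crossMoment (integral_lagVec_eq_zero hX h0 L 0) (integral_lagVec_eq_zero hX h0 L 0)

theorem inner_cov_lagVec_nonneg [IsProbabilityMeasure μ] {X : ℤ → Ω → H}
    (hX : ∀ k, MemLp (X k) 2 μ) (h0 : IsCentered μ X) (L : ℕ) (u : Lag H L) :
    0 ≤ inner ℝ (cov μ (lagVec X L 0) u) u := by
  rw [cov_lagVec_eq hX h0, inner_crossMoment (memLp_lagVec hX L 0) (memLp_lagVec hX L 0)]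
  exact integral_nonneg fun _ => mul_self_nonneg _

end YuleWalker

/-! ### From growth conditions to rates -/

section Rates

theorem inv_gap_le_gapSup (lam : ℕ → ℝ) {k : ℕ} (hk : 0 < k) :
    (lam (k - 1) - lam k)⁻¹ ≤ gapSup lam k := by
  have h := le_ciSup (f := fun j : Fin k => (lam j - lam (j + 1))⁻¹)
    (Set.finite_range _).bddAbove ⟨k - 1, by omega⟩
  simpa only [Nat.sub_add_cancel hk, gapSup] using h

/-- Consequences of the growth condition `k Λ x ≤ C λ κ` for a reciprocal gap bound `Λ`. -/
theorem rate_of_gap_rate {lam gap G x C κ B k : ℝ} (hlam : 0 < lam) (hlamB : lam ≤ B)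
    (hgap : 0 < gap) (hgaplam : gap ≤ lam) (hG : gap⁻¹ ≤ G) (hk : 1 ≤ k) (hx : 0 ≤ x)
    (hC : 0 ≤ C) (hκ : 0 ≤ κ) (h : k * G * x ≤ C * lam * κ) :
    k * x ≤ C * B * lam * κ ∧ x ≤ C * B * lam * κ ∧ x / gap ≤ C * B * κ := by
  have h1 : k * (x / gap) ≤ C * lam * κ := by
    refine le_trans ?_ h
    rw [div_eq_mul_inv, mul_comm x, ← mul_assoc]
    gcongr
  have hxg : 0 ≤ x / gap := by positivity
  have h2 : k * x ≤ C * B * lam * κ := by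
    -- As the gap is at most λ, a bound for x / gap also bounds x / λ.
    have hxl : x ≤ x / gap * lam := by
      rw [div_mul_eq_mul_div, le_div_iff₀ hgap]
      gcongr
    calc k * x ≤ k * (x / gap * lam) := by gcongr
      _ = k * (x / gap) * lam := by ring
      _ ≤ C * lam * κ * lam := by gcongr
      _ ≤ C * B * κ * lam := by gcongr
      _ = _ := by ring
  refine ⟨h2, le_trans (le_mul_of_one_le_left hx hk) h2, ?_⟩
  calc x / gap ≤ k * (x / gap) := le_mul_of_one_le_left hxg hk
    _ ≤ C * lam * κ := h1
    _ ≤ _ := by gcongr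

variable {E F : Type*} [NormedAddCommGroup E] [InnerProductSpace ℝ E] [CompleteSpace E]
  [NormedAddCommGroup F] [InnerProductSpace ℝ F] [CompleteSpace F]

/-- The rate of the regularized inverse. -/
theorem HSBound.regularized_inverse_rate {T T' : E →L[ℝ] E} {lam lam' : ℕ → ℝ}
    {e e' : HilbertBasis ℕ ℝ E} (h : IsEigenSystem T lam e) (h' : IsEigenSystem T' lam' e')
    (hT : ∀ x, 0 ≤ inner ℝ (T x) x) (hne : ∀ j, lam j ≠ lam (j + 1))
    (hT' : ∀ x, 0 ≤ inner ℝ (T' x) x) {S D : E →L[ℝ] F} {k : ℕ} (hk : 0 < k)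
    {θ δ r s t x κ B C a b b' c t₀ : ℝ} (hθ : 0 < θ) (hB : lam 0 ≤ B) (hx : 0 ≤ x) (hC : 0 ≤ C)
    (hκ : 0 ≤ κ) (hκ1 : κ ≤ 1) (hrate : k * gapSup lam k * x ≤ C * lam (k - 1) * κ)
    (ha : 0 ≤ a) (hb : 0 ≤ b) (hka : 2 * a * C * B ≤ k)
    (hδ : HSBound (T' - T) δ) (hδx : δ ≤ a * x)
    (hr : HSBound (D - S ∘L T') r) (hrx : r ≤ b * x + b' * (lam (k - 1) * κ))
    (hθx : θ ≤ c * (lam (k - 1) * κ)) (hs : HSBound S s)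
    (ht : HSBound (S - S ∘L projFirst e k) t) (htx : t ≤ t₀ * κ) :
    HSBound (D ∘L Ring.inverse (T' + θ • 1) ∘L projFirst e' k - S)
      ((2 * (b * (C * B) + b') + 2 * s * c + 4 * s * (a * (C * B)) + t₀) * κ) := by
  have hpos := h.pos hT hne
  have hgap : lam k < lam (k - 1) := by
    simpa only [Nat.sub_add_cancel hk] using h.lt_of_ne hne (k - 1)
  have hk1 : (1 : ℝ) ≤ k := by exact_mod_cast hk
  have hl := hpos (k - 1)
  have hlB : lam (k - 1) ≤ B := (h.antitone (Nat.zero_le _)).trans hB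
  have hB0 : 0 ≤ B := hl.le.trans hlB
  obtain ⟨h1, h2, h3⟩ := rate_of_gap_rate hl hlB (sub_pos.2 hgap)
    (by linarith [hpos k]) (inv_gap_le_gapSup lam hk) hk1 hx hC hκ hrate
  -- The spare factor k in `hrate` is used here: a x ≤ a C B λ / k, which `hka` makes at most λ / 2.
  have hδlam : δ ≤ lam (k - 1) / 2 := by
    have hk0 : (0 : ℝ) < k := by linarith
    refine hδx.trans (le_of_mul_le_mul_left ?_ hk0)
    calc k * (a * x) = a * (k * x) := by ring
      _ ≤ a * (C * B * lam (k - 1) * κ) := by gcongr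
      _ ≤ a * (C * B * lam (k - 1) * 1) := by gcongr
      _ = 2 * a * C * B * (lam (k - 1) / 2) := by ring
      _ ≤ _ := by gcongr
  refine (HSBound.regularized_inverse_sub h h' hT' hk hθ hl hgap hδ hδlam hr hs ht).mono ?_
  have hs0 := hs.1
  have e1 : 2 * r / lam (k - 1) ≤ 2 * (b * (C * B) + b') * κ := by
    rw [div_le_iff₀ hl]
    have : b * x ≤ b * (C * B * lam (k - 1) * κ) := by gcongr
    linarith
  have e2 : 2 * s * θ / lam (k - 1) ≤ 2 * s * c * κ := by
    rw [div_le_iff₀ hl]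
    calc 2 * s * θ ≤ 2 * s * (c * (lam (k - 1) * κ)) := by gcongr
      _ = _ := by ring
  have e3 : 4 * s * δ / (lam (k - 1) - lam k) ≤ 4 * s * (a * (C * B)) * κ := by
    have hg := sub_pos.2 hgap
    calc 4 * s * δ / (lam (k - 1) - lam k) ≤ 4 * s * (a * x) / (lam (k - 1) - lam k) := by gcongr
      _ = 4 * s * a * (x / (lam (k - 1) - lam k)) := by ring
      _ ≤ 4 * s * a * (C * B * κ) := by gcongr
      _ = _ := by ring
  linarith

end Rates

/-! ### The moving average operator from the first two coefficients -/

section SecondStage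

variable {H : Type*} [NormedAddCommGroup H] [InnerProductSpace ℝ H] [CompleteSpace H]

theorem inner_comp_adjoint_nonneg (A : H →L[ℝ] H) (x : H) :
    0 ≤ inner ℝ ((A ∘L ContinuousLinearMap.adjoint A) x) x := by
  rw [ContinuousLinearMap.comp_apply, ← ContinuousLinearMap.adjoint_inner_right]
  exact real_inner_self_nonneg

theorem HSBound.comp_adjoint_sub {A A' : H →L[ℝ] H} {r : ℝ} (h : HSBound (A' - A) r) :
    HSBound (A' ∘L ContinuousLinearMap.adjoint A' - A ∘L ContinuousLinearMap.adjoint A)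
      (r * (‖A‖ + r) + ‖A‖ * r) := by
  have hA' : ‖A'‖ ≤ ‖A‖ + r := by
    simpa using (norm_add_le A (A' - A)).trans (add_le_add le_rfl h.opNorm_le)
  have heq : A' ∘L ContinuousLinearMap.adjoint A' - A ∘L ContinuousLinearMap.adjoint A
      = (A' - A) ∘L ContinuousLinearMap.adjoint A'
        + A ∘L ContinuousLinearMap.adjoint (A' - A) := by
    rw [map_sub, ContinuousLinearMap.sub_comp, ContinuousLinearMap.comp_sub]
    abel
  rw [heq]
  exact (h.comp_right _ (by simpa using hA')).add (h.adjoint.comp_left _ le_rfl)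

/-- The limits satisfy B = -β₁ A exactly, so the residual D - S T' contains only first-stage errors,
multiplied by A'*. -/
theorem HSBound.moving_average_residual {A A' B' β₁ : H →L[ℝ] H} {r : ℝ}
    (hA : HSBound (A' - A) r) (hB : HSBound (B' - -(β₁ ∘L A)) r) :
    HSBound (-(B' ∘L ContinuousLinearMap.adjoint A')
      - β₁ ∘L A' ∘L ContinuousLinearMap.adjoint A') ((r + ‖β₁‖ * r) * (‖A‖ + r)) := by
  have hA' : ‖A'‖ ≤ ‖A‖ + r := by
    simpa using (norm_add_le A (A' - A)).trans (add_le_add le_rfl hA.opNorm_le)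
  have heq : -(B' ∘L ContinuousLinearMap.adjoint A')
      - β₁ ∘L A' ∘L ContinuousLinearMap.adjoint A'
      = -(((B' - -(β₁ ∘L A)) + β₁ ∘L (A' - A)) ∘L ContinuousLinearMap.adjoint A') := by
    ext x
    simp only [sub_apply, add_apply, neg_apply, ContinuousLinearMap.comp_apply, map_sub]
    abel
  rw [heq]
  exact ((hB.add (hA.comp_left _ le_rfl)).comp_right _ (by simpa using hA')).neg

/-- The error of the moving average operator in terms of the error of the first two coefficients. -/
theorem hsBound_betaEst_sub {L : ℕ} {P : Lag H L →L[ℝ] H} {A β₁ : H →L[ℝ] H} {rho rho' : ℕ → ℝ}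
    {f f' : HilbertBasis ℕ ℝ H} (hf : IsEigenSystem (A ∘L ContinuousLinearMap.adjoint A) rho f)
    (hf' : IsEigenSystem (component P 1 ∘L ContinuousLinearMap.adjoint (component P 1)) rho' f')
    (hrho : ∀ j, rho j ≠ rho (j + 1)) {M : ℕ} (hM : 0 < M) {g r κ m C b t : ℝ} (hg : 0 < g)
    (hr : 0 ≤ r) (hκ : 0 ≤ κ) (hκ1 : κ ≤ 1) (hC : 0 ≤ C) (hm : 0 ≤ m) (hm1 : m ≤ 1)
    (hrate : M * gapSup rho M * κ ≤ C * rho (M - 1) * m)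
    (hMl : 2 * (r * (‖A‖ + r) + ‖A‖ * r) * C * rho 0 ≤ M)
    (h1 : HSBound (component P 1 - A) (r * κ))
    (h2 : HSBound (component P 2 - -(β₁ ∘L A)) (r * κ)) (hgm : g ≤ rho (M - 1) * m)
    (hb : HSBound β₁ b) (ht : HSBound (β₁ - β₁ ∘L projFirst f M) (m * t)) :
    HSBound (betaEst P M g f' - β₁) ((2 * ((r + ‖β₁‖ * r) * (‖A‖ + r) * (C * rho 0) + 0) + 2 * b * 1
      + 4 * b * ((r * (‖A‖ + r) + ‖A‖ * r) * (C * rho 0)) + t) * m) := by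
  have hrκ : r * κ ≤ r := mul_le_of_le_one_right hr hκ1
  have heq : betaEst P M g f'
      = (-(component P 2 ∘L ContinuousLinearMap.adjoint (component P 1))) ∘L
        Ring.inverse (component P 1 ∘L ContinuousLinearMap.adjoint (component P 1) + g • 1) ∘L
        projFirst f' M := by
    rw [betaEst, ContinuousLinearMap.neg_comp, ContinuousLinearMap.comp_assoc]
  rw [heq]
  -- The first-stage rate κ plays the role of x, and m that of the target rate; b' = 0 and c = 1.
  refine HSBound.regularized_inverse_rate hf hf' (inner_comp_adjoint_nonneg _) hrho
    (inner_comp_adjoint_nonneg _) hM hg le_rfl hκ hC hm hm1 hrate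
    (by positivity) (by positivity) hMl h1.comp_adjoint_sub ?_
    (h1.moving_average_residual h2) ?_ (by linarith) hb ht (mul_comm _ _).le
  · calc r * κ * (‖A‖ + r * κ) + ‖A‖ * (r * κ) ≤ r * κ * (‖A‖ + r) + ‖A‖ * (r * κ) := by gcongr
      _ = _ := by ring
  · calc (r * κ + ‖β₁‖ * (r * κ)) * (‖A‖ + r * κ)
        ≤ (r * κ + ‖β₁‖ * (r * κ)) * (‖A‖ + r) := by gcongr
      _ = _ := by ring

end SecondStage

/-! ### Transfer of deterministic bounds to stochastic order -/

section StochasticOrder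

variable {Ω : Type*} [MeasurableSpace Ω] {μ : Measure Ω}

/-- Each bad event gets probability η / 2. Only monotonicity and subadditivity of μ are used, so the
eigenbases need not be chosen measurably. Absolute values make the constants nonnegative. -/
theorem IsBigOP.of_eventually_forall {Y₁ Y₂ Z : ℕ → Ω → ℝ≥0∞} {c₁ c₂ c : ℕ → ℝ}
    (h₁ : IsBigOP μ Y₁ c₁) (h₂ : IsBigOP μ Y₂ c₂) (hc₁ : ∀ N, 0 ≤ c₁ N) (hc₂ : ∀ N, 0 ≤ c₂ N)
    (h : ∀ C₁ C₂ : ℝ, 0 ≤ C₁ → 0 ≤ C₂ → ∃ C : ℝ, ∀ᶠ N in atTop, ∀ ω,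
      Y₁ N ω ≤ ENNReal.ofReal (C₁ * c₁ N) → Y₂ N ω ≤ ENNReal.ofReal (C₂ * c₂ N) →
        Z N ω ≤ ENNReal.ofReal (C * c N)) : IsBigOP μ Z c := by
  intro η hη
  obtain ⟨C₁, hC₁⟩ := h₁ (η / 2) (ENNReal.half_pos hη.ne')
  obtain ⟨C₂, hC₂⟩ := h₂ (η / 2) (ENNReal.half_pos hη.ne')
  obtain ⟨C, hC⟩ := h |C₁| |C₂| (abs_nonneg _) (abs_nonneg _)
  refine ⟨C, ?_⟩
  filter_upwards [hC₁, hC₂, hC] with N h1 h2 h3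
  calc μ {ω | ENNReal.ofReal (C * c N) < Z N ω}
      ≤ μ ({ω | ENNReal.ofReal (C₁ * c₁ N) < Y₁ N ω} ∪ {ω | ENNReal.ofReal (C₂ * c₂ N) < Y₂ N ω}) := by
        refine measure_mono fun ω hω => ?_
        by_contra hn
        simp only [Set.mem_union, Set.mem_ofPred_eq, not_or, not_lt] at hn hω
        refine absurd (h3 ω (hn.1.trans ?_) (hn.2.trans ?_)) (not_le.2 hω)
        · exact ENNReal.ofReal_le_ofReal (mul_le_mul_of_nonneg_right (le_abs_self _) (hc₁ N))
        · exact ENNReal.ofReal_le_ofReal (mul_le_mul_of_nonneg_right (le_abs_self _) (hc₂ N))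
    _ ≤ _ := measure_union_le _ _
    _ ≤ η / 2 + η / 2 := add_le_add h1 h2
    _ = η := ENNReal.add_halves η

end StochasticOrder

end FARMA

/-! ### The convergence rate -/

theorem mainTheorem5
    {H : Type*} [NormedAddCommGroup H] [InnerProductSpace ℝ H] [CompleteSpace H]
    [SecondCountableTopology H] [MeasurableSpace H] [BorelSpace H]
    (hdim : ¬ FiniteDimensional ℝ H)
    {Ω : Type*} [MeasurableSpace Ω] (μ : Measure Ω) [IsProbabilityMeasure μ]
    -- the process, its errors and its operators
    (X ε : ℤ → Ω → H) (α₁ β₁ : H →L[ℝ] H) (ψ φ : ℕ → H →L[ℝ] H)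
    (harma : IsFARMA11 μ X ε α₁ β₁)
    (hlin : IsCausalLinear μ X ε φ)
    (hinv : IsInvertible μ X ε ψ)
    (hX : ∀ k, MemLp (X k) 2 μ)
    (hε : ∀ k, MemLp (ε k) 4 μ)
    (hεstat : IsStrictlyStationary μ ε) (hεerg : IsErgodic μ ε)
    (hCε : Function.Injective (cov μ (ε 0)))
    -- the tuning sequences
    (K L M : ℕ → ℕ) (θ g : ℕ → ℝ)
    (hKpos : ∀ N, 0 < K N) (hLpos : ∀ N, 0 < L N) (hMpos : ∀ N, 0 < M N)
    (hK : Tendsto K atTop atTop) (hL : Tendsto L atTop atTop) (hM : Tendsto M atTop atTop)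
    (hθpos : ∀ N, 0 < θ N) (hθ : Tendsto θ atTop (𝓝 0))
    (hgpos : ∀ N, 0 < g N) (hg : Tendsto g atTop (𝓝 0))
    -- rates of the empirical covariance operators
    (hLo : (fun N => (L N : ℝ)) =o[atTop] fun N => (N : ℝ) ^ (1 / 3 : ℝ))
    (hC : IsBigOP μ (fun N ω => hsENorm (empCov X (L N) N ω - cov μ (lagVec X (L N) 0)))
      fun N => (L N : ℝ) ^ (3 / 2 : ℝ) * (N : ℝ) ^ (-(1 / 2) : ℝ))
    (hD : IsBigOP μ
      (fun N ω => hsENorm (empCross X (L N) N ω - crossCov μ (lagVec X (L N) 0) (X 1)))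
      fun N => (L N : ℝ) * (N : ℝ) ^ (-(1 / 2) : ℝ))
    -- eigenpairs of the covariance operators of the lagged vectors, of `X`, and of `ψ₁ ψ₁*`
    (lam : ℕ → ℕ → ℝ) (c : ∀ N, HilbertBasis ℕ ℝ (Lag H (L N)))
    (hc : ∀ N, IsEigenSystem (cov μ (lagVec X (L N) 0)) (lam N) (c N))
    (hlam : ∀ N j, lam N j ≠ lam N (j + 1))
    (mu : ℕ → ℝ) (d : HilbertBasis ℕ ℝ H) (hd : IsEigenSystem (cov μ (X 0)) mu d)
    (rho : ℕ → ℝ) (f : HilbertBasis ℕ ℝ H)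
    (hf : IsEigenSystem (ψ 1 ∘L ContinuousLinearMap.adjoint (ψ 1)) rho f)
    (hrho : ∀ j, rho j ≠ rho (j + 1))
    -- conditions on the operators
    (hψS : ∑' i : ℕ, hsENorm (ψ (i + 1)) ^ 2 < ∞)
    (hαS : IsHS α₁) (hβS : IsHS β₁)
    (hψ1 : DenseRange (ψ 1))
    (β : ℝ) (hβ : 0 < β)
    (hsobψ : ∀ N, sobolevSum (rowOp ψ (L N)) (c N) d β < ∞)
    (hsobψtail : ∃ B : ℝ≥0, ∀ᶠ N in atTop,
      sobolevTail (rowOp ψ (L N)) (c N) d β (K N) ≤ B)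
    (γ : ℝ) (hγ : 0 < γ)
    (hsobβ : sobolevSum β₁ f f γ < ∞)
    -- growth conditions
    (hθlam : θ =o[atTop] fun N => lam N (K N - 1))
    (hKL : (fun N => (K N : ℝ) ^ (1 + β) * (lam N (K N - 1))⁻¹ * gapSup (lam N) (K N)
        * (L N : ℝ) ^ 2) =O[atTop] fun N => (N : ℝ) ^ (1 / 2 : ℝ))
    (hψsum : Summable fun l : ℕ => ‖ψ (l + 1)‖)
    (hψtail : (fun N => ∑' l : ℕ, ‖ψ (L N + 1 + l)‖) =o[atTop] fun N =>
      (K N : ℝ) * gapSup (lam N) (K N) * (L N : ℝ) ^ (3 / 2 : ℝ) * (N : ℝ) ^ (-(1 / 2) : ℝ))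
    (hθK : θ =o[atTop] fun N =>
      (K N : ℝ) * gapSup (lam N) (K N) * (L N : ℝ) ^ 2 * (N : ℝ) ^ (-(1 / 2) : ℝ))
    (hMK : (fun N => (M N : ℝ) ^ (1 + γ) * (rho (M N - 1))⁻¹ * gapSup rho (M N))
      =O[atTop] fun N => (K N : ℝ) ^ β)
    (hgM : g =o[atTop] fun N => rho (M N - 1) * (M N : ℝ) ^ (-γ))
    -- eigenpairs entering the estimators, for every sample size and every outcome
    (lamHat : ℕ → Ω → ℕ → ℝ) (cHat : ∀ N, Ω → HilbertBasis ℕ ℝ (Lag H (L N)))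
    (hcHat : ∀ N ω, IsEigenSystem (empCov X (L N) N ω) (lamHat N ω) (cHat N ω))
    (PsiHat : ∀ N, Ω → (Lag H (L N) →L[ℝ] H))
    (hPsiHat : ∀ N ω, PsiHat N ω = rowEst X (L N) N (K N) (θ N) (cHat N ω) ω)
    (rhoHat : ℕ → Ω → ℕ → ℝ) (fHat : ℕ → Ω → HilbertBasis ℕ ℝ H)
    (hfHat : ∀ N ω, IsEigenSystem (component (PsiHat N ω) 1 ∘L
      ContinuousLinearMap.adjoint (component (PsiHat N ω) 1)) (rhoHat N ω) (fHat N ω)) :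
    IsBigOP μ
      (fun N ω => max (hsENorm (alphaEst (PsiHat N ω) (M N) (g N) (fHat N ω) - α₁))
        (hsENorm (betaEst (PsiHat N ω) (M N) (g N) (fHat N ω) - β₁)))
      fun N => (M N : ℝ) ^ (-γ) := by
  have hX0 := hinv.centered
  have hε2 := harma.whiteNoise.memLp
  have hunc : ∀ k l, k ≠ l → crossMoment μ (ε k) (ε l) = 0 := fun k l hkl => by
    rw [← crossCov_eq_crossMoment (harma.whiteNoise.centered k) (harma.whiteNoise.centered l)]
    exact harma.whiteNoise.uncorrelated k l hkl
  obtain ⟨hψ1eq, hψ2eq⟩ := coeff_eq_of_arma harma hlin hinv hX hεstat hCε hψsum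
  obtain ⟨B₀, hB₀⟩ := exists_inner_crossMoment_lagVec_le hlin hX hε2 (hε2 0).2.ne
    (fun k => (hεstat.eLpNorm_eq 2 k).le) hunc
  have hlam0 : ∀ N, lam N 0 ≤ B₀ := fun N => by
    rw [(hc N).eq_inner 0, cov_lagVec_eq hX hX0]
    exact hB₀ _ _ ((c N).orthonormal.1 0)
  obtain ⟨s, hs⟩ := exists_hsBound_rowOp hψS
  have hT : ∀ N x, 0 ≤ inner ℝ (cov μ (lagVec X (L N) 0) x) x :=
    fun N => inner_cov_lagVec_nonneg hX hX0 (L N)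
  set σ := (eLpNorm (X 0) 2 μ).toReal
  obtain ⟨B₁, hB₁⟩ := hsobψtail
  obtain ⟨C₃, hC₃, hKL'⟩ := hKL.exists_nonneg
  obtain ⟨C₄, hC₄, hMK'⟩ := hMK.exists_nonneg
  obtain ⟨b, hb⟩ : ∃ b : ℝ, HSBound β₁ b :=
    ⟨(hsENorm β₁).toReal, ENNReal.toReal_nonneg, (ENNReal.ofReal_toReal (ne_of_lt hβS)).ge⟩
  refine hC.of_eventually_forall hD (fun N => by positivity) (fun N => by positivity) ?_
  intro C₁ C₂ hC₁ hC₂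
  -- the rate of the Yule-Walker estimator
  obtain ⟨C₅, hC₅, hstage⟩ : ∃ C₅ : ℝ, 0 ≤ C₅ ∧ ∀ᶠ N in atTop, ∀ ω,
      hsENorm (empCov X (L N) N ω - cov μ (lagVec X (L N) 0)) ≤
        ENNReal.ofReal (C₁ * ((L N : ℝ) ^ (3 / 2 : ℝ) * (N : ℝ) ^ (-(1 / 2) : ℝ))) →
      hsENorm (empCross X (L N) N ω - crossCov μ (lagVec X (L N) 0) (X 1)) ≤
        ENNReal.ofReal (C₂ * ((L N : ℝ) * (N : ℝ) ^ (-(1 / 2) : ℝ))) →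
      HSBound (PsiHat N ω - rowOp ψ (L N)) (C₅ * (K N : ℝ) ^ (-β)) := by
    refine ⟨|2 * ((C₂ + s * C₁) * (C₃ * B₀) + C₃ * σ ^ 2) + 2 * s * C₃
      + 4 * s * (C₁ * (C₃ * B₀)) + Real.sqrt B₁|, abs_nonneg _, ?_⟩
    have hKlarge : ∀ᶠ N in atTop, 2 * C₁ * C₃ * B₀ ≤ (K N : ℝ) :=
      (tendsto_natCast_atTop_atTop.comp hK).eventually_ge_atTop _
    -- Makes the normalization of `empCov` positive, hence the operator positive semidefinite.
    have hLN : ∀ᶠ N in atTop, L N ≤ N := by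
      filter_upwards [hLo.bound one_pos, eventually_ge_atTop 1] with N h1 hN
      have hN' : (1 : ℝ) ≤ N := by exact_mod_cast hN
      rw [Real.norm_of_nonneg (by positivity), Real.norm_of_nonneg (by positivity), one_mul] at h1
      have : (N : ℝ) ^ (1 / 3 : ℝ) ≤ (N : ℝ) ^ (1 : ℝ) :=
        Real.rpow_le_rpow_of_exponent_le hN' (by norm_num)
      rw [Real.rpow_one] at this
      exact_mod_cast h1.trans this
    filter_upwards [hKlarge, hLN, hB₁, hKL'.bound, hψtail.bound one_pos, hθK.bound one_pos,
      eventually_ge_atTop 1] with N hKl hLN hB hkl hpt hth hN ω hCω hDω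
    have hN0 : (0 : ℝ) < N := by exact_mod_cast hN
    have hK1 : (1 : ℝ) ≤ K N := by exact_mod_cast hKpos N
    have hK0 : (0 : ℝ) < K N := by linarith
    have hL1 : (1 : ℝ) ≤ L N := by exact_mod_cast hLpos N
    have hL0 : (0 : ℝ) < L N := by linarith
    have hl := (hc N).pos (hT N) (hlam N) (K N - 1)
    have hgap : lam N (K N) < lam N (K N - 1) := by
      simpa only [Nat.sub_add_cancel (hKpos N)] using (hc N).lt_of_ne (hlam N) (K N - 1)
    have hG : 0 ≤ gapSup (lam N) (K N) :=
      (inv_nonneg.2 (sub_pos.2 hgap).le).trans (inv_gap_le_gapSup (lam N) (hKpos N))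
    set n : ℝ := (N : ℝ) ^ (-(1 / 2) : ℝ) with hn
    have hn0 : 0 < n := by positivity
    have hnN : (N : ℝ) ^ (1 / 2 : ℝ) * n = 1 := by
      rw [hn, ← Real.rpow_add hN0]
      norm_num
    set κ : ℝ := (K N : ℝ) ^ (-β) with hκ
    have hκ0 : 0 < κ := by positivity
    have hκ1 : κ ≤ 1 := Real.rpow_le_one_of_one_le_of_nonpos hK1 (by linarith)
    have hKκ : (K N : ℝ) ^ (1 + β) * κ = K N := by
      rw [hκ, ← Real.rpow_add hK0]
      simp
    have hL32 : (L N : ℝ) ^ (3 / 2 : ℝ) ≤ (L N : ℝ) ^ 2 := by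
      rw [← Real.rpow_two]
      exact Real.rpow_le_rpow_of_exponent_le hL1 (by norm_num)
    have hLsq : Real.sqrt (L N) * (L N : ℝ) ^ (3 / 2 : ℝ) = (L N : ℝ) ^ 2 := by
      rw [Real.sqrt_eq_rpow, ← Real.rpow_add hL0, ← Real.rpow_two]
      norm_num
    have hL12 : (L N : ℝ) ≤ (L N : ℝ) ^ 2 := by nlinarith
    have hrate : (K N : ℝ) * gapSup (lam N) (K N) * ((L N : ℝ) ^ 2 * n)
        ≤ C₃ * lam N (K N - 1) * κ := by
      rw [Real.norm_of_nonneg (by positivity), Real.norm_of_nonneg (by positivity)] at hkl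
      calc (K N : ℝ) * gapSup (lam N) (K N) * ((L N : ℝ) ^ 2 * n)
          = (K N : ℝ) ^ (1 + β) * κ * gapSup (lam N) (K N) * ((L N : ℝ) ^ 2 * n) := by rw [hKκ]
        _ = ((K N : ℝ) ^ (1 + β) * (lam N (K N - 1))⁻¹ * gapSup (lam N) (K N) * (L N : ℝ) ^ 2)
            * (lam N (K N - 1) * κ * n) := by
            field_simp
        _ ≤ (C₃ * (N : ℝ) ^ (1 / 2 : ℝ)) * (lam N (K N - 1) * κ * n) := by gcongr
        _ = C₃ * lam N (K N - 1) * κ * ((N : ℝ) ^ (1 / 2 : ℝ) * n) := by ring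
        _ = _ := by rw [hnN, mul_one]
    -- The √L from the norm of the lagged vector raises L^(3/2) in the tail condition to the L² of
    -- `hrate`.
    have hτ : Real.sqrt (L N) * ∑' l : ℕ, ‖ψ (L N + 1 + l)‖ ≤ C₃ * lam N (K N - 1) * κ := by
      refine le_trans ?_ hrate
      rw [one_mul, Real.norm_of_nonneg (tsum_nonneg fun _ => norm_nonneg _),
        Real.norm_of_nonneg (by positivity)] at hpt
      calc Real.sqrt (L N) * ∑' l : ℕ, ‖ψ (L N + 1 + l)‖
          ≤ Real.sqrt (L N) * ((K N : ℝ) * gapSup (lam N) (K N) * (L N : ℝ) ^ (3 / 2 : ℝ) * n) := by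
            gcongr
        _ = (K N : ℝ) * gapSup (lam N) (K N)
            * ((Real.sqrt (L N) * (L N : ℝ) ^ (3 / 2 : ℝ)) * n) := by ring
        _ = _ := by rw [hLsq]
    have hθ' : θ N ≤ C₃ * (lam N (K N - 1) * κ) := by
      rw [← mul_assoc]
      refine le_trans ?_ hrate
      rw [one_mul, Real.norm_of_nonneg (hθpos N).le, Real.norm_of_nonneg (by positivity)] at hth
      linarith
    have hδ : HSBound (empCov X (L N) N ω - cov μ (lagVec X (L N) 0))
        (C₁ * ((L N : ℝ) ^ (3 / 2 : ℝ) * n)) := ⟨by positivity, hCω⟩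
    have hδD : HSBound (empCross X (L N) N ω - crossCov μ (lagVec X (L N) 0) (X 1))
        (C₂ * (L N * n)) := ⟨by positivity, hDω⟩
    have hYW := hsBound_crossCov_sub_rowOp_comp_cov harma.whiteNoise hlin hinv hX hεstat hψsum
      (L N) (c N)
    -- D̂ - Ψ Ĉ = (D̂ - D) + (D - Ψ C) - Ψ (Ĉ - C).
    have hr := (hδD.add hYW).sub (hδ.comp_left (rowOp ψ (L N)) (hs (L N)).opNorm_le)
    rw [show empCross X (L N) N ω - crossCov μ (lagVec X (L N) 0) (X 1)
        + (crossCov μ (lagVec X (L N) 0) (X 1) - rowOp ψ (L N) ∘L cov μ (lagVec X (L N) 0))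
        - rowOp ψ (L N) ∘L (empCov X (L N) N ω - cov μ (lagVec X (L N) 0))
        = empCross X (L N) N ω - rowOp ψ (L N) ∘L empCov X (L N) N ω by
      rw [ContinuousLinearMap.comp_sub]; abel] at hr
    have hs0 := (hs (L N)).1
    rw [hPsiHat, rowEst]
    refine (HSBound.regularized_inverse_rate (hc N) (hcHat N ω) (hT N) (hlam N)
      (empCov_nonneg X hLN ω) (hKpos N) (hθpos N) (hlam0 N) (x := (L N : ℝ) ^ 2 * n)
      (by positivity) hC₃ hκ0.le hκ1 hrate hC₁ (b := C₂ + s * C₁) (b' := C₃ * σ ^ 2)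
      (by positivity) hKl hδ (by gcongr) hr ?_ hθ' (hs (L N))
      (HSBound.sub_comp_projFirst _ (c N) d hβ (hKpos N) hB) (t₀ := Real.sqrt B₁)
      (mul_comm _ _).le).mono (mul_le_mul_of_nonneg_right (le_abs_self _) hκ0.le)
    calc C₂ * (L N * n) + Real.sqrt (L N) * (∑' l : ℕ, ‖ψ (L N + 1 + l)‖) * σ ^ 2
          + s * (C₁ * ((L N : ℝ) ^ (3 / 2 : ℝ) * n))
        ≤ C₂ * ((L N : ℝ) ^ 2 * n) + C₃ * lam N (K N - 1) * κ * σ ^ 2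
          + s * (C₁ * ((L N : ℝ) ^ 2 * n)) := by gcongr
      _ = _ := by ring
  -- the rate of the estimators of `β₁` and `α₁`
  have hrpos := hf.pos (inner_comp_adjoint_nonneg (ψ 1)) hrho
  set B₂ : ℝ≥0 := (sobolevSum β₁ f f γ).toNNReal with hB₂
  have hB₂' : ∀ k, sobolevTail β₁ f f γ k ≤ B₂ := fun k =>
    (sobolevTail_le _ _ _ _ _).trans (by rw [hB₂, ENNReal.coe_toNNReal hsobβ.ne])
  have hb0 := hb.1
  set a₂ : ℝ := C₅ * (‖ψ 1‖ + C₅) + ‖ψ 1‖ * C₅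
  set C₆ : ℝ := 2 * ((C₅ + ‖β₁‖ * C₅) * (‖ψ 1‖ + C₅) * (C₄ * rho 0) + 0) + 2 * b * 1
    + 4 * b * (a₂ * (C₄ * rho 0)) + Real.sqrt B₂
  refine ⟨C₅ * (C₄ * rho 0 * rho 0) + C₆, ?_⟩
  have hMlarge : ∀ᶠ N in atTop, 2 * a₂ * C₄ * rho 0 ≤ (M N : ℝ) :=
    (tendsto_natCast_atTop_atTop.comp hM).eventually_ge_atTop _
  -- At least two lags are needed for both components 1 and 2 to exist.
  filter_upwards [hstage, hMlarge, hMK'.bound, hgM.bound one_pos, hL.eventually_ge_atTop 2]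
    with N hst hMl hmk hgm hL2 ω hCω hDω
  have hΨ := hst ω hCω hDω
  have hK1 : (1 : ℝ) ≤ K N := by exact_mod_cast hKpos N
  have hK0 : (0 : ℝ) < K N := by linarith
  have hM1 : (1 : ℝ) ≤ M N := by exact_mod_cast hMpos N
  have hM0 : (0 : ℝ) < M N := by linarith
  set κ : ℝ := (K N : ℝ) ^ (-β) with hκ
  have hκ0 : 0 < κ := by positivity
  have hκ1 : κ ≤ 1 := Real.rpow_le_one_of_one_le_of_nonpos hK1 (by linarith)
  have hKκ : (K N : ℝ) ^ β * κ = 1 := by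
    rw [hκ, ← Real.rpow_add hK0]
    simp
  set m : ℝ := (M N : ℝ) ^ (-γ) with hm
  have hm0 : 0 < m := by positivity
  have hm1 : m ≤ 1 := Real.rpow_le_one_of_one_le_of_nonpos hM1 (by linarith)
  have hMm : (M N : ℝ) ^ (1 + γ) * m = M N := by
    rw [hm, ← Real.rpow_add hM0]
    simp
  have hl := hrpos (M N - 1)
  have hgap : rho (M N) < rho (M N - 1) := by
    simpa only [Nat.sub_add_cancel (hMpos N)] using hf.lt_of_ne hrho (M N - 1)
  have hGinv := inv_gap_le_gapSup rho (hMpos N)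
  have hG : 0 ≤ gapSup rho (M N) := (inv_nonneg.2 (sub_pos.2 hgap).le).trans hGinv
  have hrate : (M N : ℝ) * gapSup rho (M N) * κ ≤ C₄ * rho (M N - 1) * m := by
    rw [Real.norm_of_nonneg (by positivity), Real.norm_of_nonneg (by positivity)] at hmk
    calc (M N : ℝ) * gapSup rho (M N) * κ
        = (M N : ℝ) ^ (1 + γ) * m * gapSup rho (M N) * κ := by rw [hMm]
      _ = ((M N : ℝ) ^ (1 + γ) * (rho (M N - 1))⁻¹ * gapSup rho (M N))
          * (rho (M N - 1) * m * κ) := by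
          field_simp
      _ ≤ (C₄ * (K N : ℝ) ^ β) * (rho (M N - 1) * m * κ) := by gcongr
      _ = C₄ * rho (M N - 1) * m * ((K N : ℝ) ^ β * κ) := by ring
      _ = _ := by rw [hKκ, mul_one]
  have h1 : HSBound (component (PsiHat N ω) 1 - ψ 1) (C₅ * κ) := by
    have := hΨ.component 1
    rwa [component_sub, component_rowOp ψ (j := 0) (by omega)] at this
  have h2 : HSBound (component (PsiHat N ω) 2 - -(β₁ ∘L ψ 1)) (C₅ * κ) := by
    have := hΨ.component 2
    rwa [component_sub, component_rowOp ψ (j := 1) (by omega), hψ2eq] at this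
  have hCκ : C₅ * κ ≤ C₅ := mul_le_of_le_one_right hC₅ hκ1
  have hβ' : HSBound (betaEst (PsiHat N ω) (M N) (g N) (fHat N ω) - β₁) (C₆ * m) := by
    have hgm' : g N ≤ rho (M N - 1) * m := by
      rwa [one_mul, Real.norm_of_nonneg (hgpos N).le, Real.norm_of_nonneg (by positivity)] at hgm
    exact hsBound_betaEst_sub hf (hfHat N ω) hrho (hMpos N) (hgpos N) hC₅ hκ0.le hκ1 hC₄ hm0.le hm1
      hrate hMl h1 h2 hgm' hb (HSBound.sub_comp_projFirst _ f f hγ (hMpos N) (hB₂' _))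
  have hC₆0 : 0 ≤ C₆ := le_of_mul_le_mul_right (by simpa using hβ'.1) hm0
  -- The coupling of M to K makes K^(-β) at most a constant times M^(-γ), so the error of ψ̂₁ does
  -- not spoil the rate for α̂₁.
  have hκm : C₅ * κ ≤ C₅ * (C₄ * rho 0 * rho 0) * m := by
    have h := (rate_of_gap_rate hl (hf.antitone (Nat.zero_le _)) (sub_pos.2 hgap)
      (by linarith [hrpos (M N)]) hGinv hM1 hκ0.le hC₄ hm0.le hrate).2.1
    have hr0 := (hrpos 0).le
    calc C₅ * κ ≤ C₅ * (C₄ * rho 0 * rho (M N - 1) * m) := by gcongr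
      _ ≤ C₅ * (C₄ * rho 0 * rho 0 * m) := by gcongr; exact hf.antitone (Nat.zero_le _)
      _ = _ := by ring
  have hα' : HSBound (alphaEst (PsiHat N ω) (M N) (g N) (fHat N ω) - α₁)
      ((C₅ * (C₄ * rho 0 * rho 0) + C₆) * m) := by
    rw [alphaEst, show component (PsiHat N ω) 1 - betaEst (PsiHat N ω) (M N) (g N) (fHat N ω) - α₁
      = (component (PsiHat N ω) 1 - ψ 1)
        - (betaEst (PsiHat N ω) (M N) (g N) (fHat N ω) - β₁) by rw [hψ1eq]; abel]
    exact (h1.sub hβ').mono (by linarith)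
  have hβ'' := hβ'.mono (s := (C₅ * (C₄ * rho 0 * rho 0) + C₆) * m)
    (by linarith [(mul_nonneg hC₅ hκ0.le).trans hκm])
  exact max_le hα'.2 hβ''.2
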